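/- Consider the following discrete-time cloud computing system. There are $M\ge 1$ servers, $I$ kinds of resources and $J$ types of jobs. Server $m$ has $R_{i,m}\ge 0$ units of resource $i$, and a type-$j$ job uses $r_{i,j}\ge 0$ units of resource $i$ while it is served. Job sizes (numbers of time slots of service) are integers in $\{1,\dots,D_{\max}\}$. A configuration $s\in\mathbb{Z}_+^J$ is feasible on server $m$ if $\sum_j s_j r_{i,j}\le R_{i,m}$ for all $i$, and maximal if moreover $s+e_{j}$ is infeasible for every $j$. Let $\mathcal{C}_m^*$ be the convex hull of the maximal configurations of server $m$, let $\mathcal{C}_m=\{s\in\mathbb{R}_+^J: s\le s^*\text{ for some }s^*\in\mathcal{C}_m^*\}$, and let $\mathcal{C}=\{s\in\mathbb{R}_+^J : s\le\sum_m s^m \text{ for some } s^m\in\mathcal{C}_m\}$ be the capacity region; it is assumed to have nonempty interior. Let $\mathcal{H}^{(k)}=\{s:\langle c^{(k)},s\rangle=b^{(k)}\}$, $k=1,\dots,K$, with $\|c^{(k)}\|=1$, $c^{(k)}\ge0$, $b^{(k)}\ge 0$, be its bounding hyperplanes: $\mathcal{C}=\{s\ge 0:\langle c^{(k)},s\rangle\le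 b^{(k)},\ k=1,\dots,K\}$, where none of the $K$ inequalities can be omitted. The state at time $t$ is the list of remaining sizes of the type-$j$ jobs at server $m$, for all $j,m$; $q_{j,m}(t)$ is the sum of these sizes. In each time slot, a random finite list of jobs of each type arrives, i.i.d. over time slots; $a_j(t)$ is the total size of the arriving type-$j$ jobs and $\lambda_j=\mathbb{E}[a_j(t)]$. JSQ routing: all arriving type-$j$ jobs join a server $m$ with the smallest $q_{j,m}(t)$, ties being broken uniformly at random. MaxWeight scheduling: server $m$ chooses a schedule $\overline{s}^m\in\mathcal{C}_m^*\cap\mathbb{Z}^J$ that maximizes $\sum_j s_j q_{j,m}(t)$ over $s\in\mathcal{C}_m^*$; then $\overline{s}^m_j$ of its type-$j$ jobs (all of them, if there are fewer), arrivals included, receive one unit of service, and completed jobs leave. Ties between schedules are broken, and the jobs to be served are selected, by arbitrary, possibly randomized rules, the former depending on the state at the beginning of the slot and the latter on the state after the arrivals and on the schedules. The state process is then a Markov chain. For $\lambda\in\mathcal{C}$ let $\epsilon^{(k)}$ be the distance from $\lambda$ to $\mathcal{H}^{(k)}$ and $\lambda^{(k)}=\lambda+\epsilon^{(k)}c^{(k)}$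 the closest point on $\mathcal{H}^{(k)}$, and let $\mathcal{K}^o_\lambda$ be the set of those $k$ for which $\lambda^{(k)}\in\mathcal{C}$ and $\lambda^{(k)}$ lies in the relative interior of the face $\mathcal{C}\cap\mathcal{H}^{(k)}$. Let $\mathbf{c}^{(k)}\in\mathbb{R}^{JM}$ have entries $\mathbf{c}^{(k)}_{j,m}=c^{(k)}_j/\sqrt{M}$, and put $\mathbf{q}^{(k)}_{\perp}=\mathbf{q}-\langle\mathbf{c}^{(k)},\mathbf{q}\rangle\mathbf{c}^{(k)}$. **Proposition.** Assume that all servers are identical, i.e. $R_{i,m}=R_i$ for all $i,m$. Fix $k$, a point $p\in\mathbb{R}^J$ and a bound $A_{\max}$ on the arrivals. Then there are finite constants $N^{(k)}_r$, $r=1,2,\dots$, such that the following holds for every law of the arrivals with $a_j(t)\le A_{\max}$ almost surely for all $j$, with mean $\lambda\in\mathcal{C}$, with $\epsilon^{(k)}>0$, $\lambda^{(k)}=p$ (that is, $\lambda=p-\epsilon^{(k)}c^{(k)}$) and $k\in\mathcal{K}^o_\lambda$: under JSQ routing and MaxWeight scheduling the Markov chain has a steady-state (invariant) distribution, and in every steady-state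 distribution $$\mathbb{E}\big[\|\mathbf{q}^{(k)}_{\perp}\|^r\big]\le N^{(k)}_r\qquad\text{for all } r=1,2,\dots .$$ In particular the constants $N_r^{(k)}$ do not depend on $\epsilon^{(k)}$. -/

import Mathlib

open scoped NNReal ENNReal

/-- A cloud computing system with `I` kinds of resources, `J` types of jobs and `M` servers.
`R i m` is the amount of resource `i` at server `m`, `r i j` the amount of resource `i` used by a
type-`j` job while it is served, and `Dmax` the maximal size (in time slots) of a job. -/
structure CloudSystem (I J M : ℕ) where
  R : Fin I → Fin M → ℝ≥0
  r : Fin I → Fin J → ℝ≥0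
  Dmax : ℕ

namespace CloudSystem

noncomputable section

variable {I J M : ℕ}

/-! ### Configurations and the capacity region -/

/-- Server `m` can serve `s j` jobs of type `j` simultaneously, for all `j`. -/
def Feasible (S : CloudSystem I J M) (m : Fin M) (s : Fin J → ℕ) : Prop :=
  ∀ i, ∑ j, (s j : ℝ≥0) * S.r i j ≤ S.R i m

/-- A feasible configuration to which no further job can be added. -/
def Maximal (S : CloudSystem I J M) (m : Fin M) (s : Fin J → ℕ) : Prop :=
  S.Feasible m s ∧ ∀ j, ¬ S.Feasible m (s + Pi.single j 1)

/-- A configuration as a vector of `ℝ^J`. -/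
def toVec (s : Fin J → ℕ) : EuclideanSpace ℝ (Fin J) :=
  WithLp.toLp 2 (fun j => (s j : ℝ))

/-- The convex hull of the maximal configurations of server `m`. -/
def hullMaximal (S : CloudSystem I J M) (m : Fin M) : Set (EuclideanSpace ℝ (Fin J)) :=
  convexHull ℝ (toVec '' {s | S.Maximal m s})

/-- The capacity region of server `m`. -/
def serverRegion (S : CloudSystem I J M) (m : Fin M) : Set (EuclideanSpace ℝ (Fin J)) :=
  {s | (∀ j, 0 ≤ s j) ∧ ∃ t ∈ S.hullMaximal m, ∀ j, s j ≤ t j}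

/-- The capacity region of the system. -/
def capacityRegion (S : CloudSystem I J M) : Set (EuclideanSpace ℝ (Fin J)) :=
  {s | (∀ j, 0 ≤ s j) ∧ ∃ t : Fin M → EuclideanSpace ℝ (Fin J),
    (∀ m, t m ∈ S.serverRegion m) ∧ ∀ j, s j ≤ ∑ m, t m j}

/-! ### Hyperplanes bounding the capacity region -/

/-- The hyperplanes `⟨c k, x⟩ = b k`, `k : Fin K`, with nonnegative unit normals and `b k ≥ 0`,
are the bounding hyperplanes of the capacity region: together with the nonnegativity constraints
they describe the region, and none of them is superfluous. -/
structure IsBoundedBy (S : CloudSystem I J M) {K : ℕ}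
    (c : Fin K → EuclideanSpace ℝ (Fin J)) (b : Fin K → ℝ) : Prop where
  norm_eq_one : ∀ k, ‖c k‖ = 1
  normal_nonneg : ∀ k j, 0 ≤ c k j
  offset_nonneg : ∀ k, 0 ≤ b k
  region_eq : S.capacityRegion = {s | (∀ j, 0 ≤ s j) ∧ ∀ k, inner ℝ (c k) s ≤ b k}
  irredundant : ∀ k,
    S.capacityRegion ≠ {s | (∀ j, 0 ≤ s j) ∧ ∀ l, l ≠ k → inner ℝ (c l) s ≤ b l}

/-- The hyperplane `⟨c, x⟩ = b`. -/
def hyperplane (c : EuclideanSpace ℝ (Fin J)) (b : ℝ) : Set (EuclideanSpace ℝ (Fin J)) :=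
  {s | inner ℝ c s = b}

/-- The distance from `lam` to the hyperplane `⟨c, x⟩ = b`. -/
def distTo (c : EuclideanSpace ℝ (Fin J)) (b : ℝ) (lam : EuclideanSpace ℝ (Fin J)) : ℝ :=
  Metric.infDist lam (hyperplane c b)

/-- For `lam` below the hyperplane, its closest point on the hyperplane, `lam + ε c`. -/
def closestPoint (c : EuclideanSpace ℝ (Fin J)) (b : ℝ) (lam : EuclideanSpace ℝ (Fin J)) :
    EuclideanSpace ℝ (Fin J) :=
  lam + distTo c b lam • c

/-- The hyperplanes for which the closest point to `lam` belongs to the capacity region. -/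
def dominant (S : CloudSystem I J M) {K : ℕ} (c : Fin K → EuclideanSpace ℝ (Fin J))
    (b : Fin K → ℝ) (lam : EuclideanSpace ℝ (Fin J)) : Set (Fin K) :=
  {k | closestPoint (c k) (b k) lam ∈ S.capacityRegion}

/-- The dominant hyperplanes for which the closest point to `lam` lies in the relative interior of
the face cut out of the capacity region by the hyperplane. -/
def dominantInterior (S : CloudSystem I J M) {K : ℕ} (c : Fin K → EuclideanSpace ℝ (Fin J))
    (b : Fin K → ℝ) (lam : EuclideanSpace ℝ (Fin J)) : Set (Fin K) :=
  {k | k ∈ S.dominant c b lam ∧ closestPoint (c k) (b k) lam ∈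
    intrinsicInterior ℝ (S.capacityRegion ∩ hyperplane (c k) (b k))}

/-! ### The queueing process -/

/-- Sizes of (backlogged) jobs. -/
abbrev JobSize (S : CloudSystem I J M) : Type := {d : ℕ // 1 ≤ d ∧ d ≤ S.Dmax}

/-- The sizes of the jobs in a list. -/
def sizes {S : CloudSystem I J M} (L : List S.JobSize) : Multiset ℕ :=
  (L.map Subtype.val : List ℕ)

/-- The total work of a list of jobs. -/
def work {S : CloudSystem I J M} (L : List S.JobSize) : ℕ := (sizes L).sum

/-- A state of the system: for every type `j` and server `m` the list of the remaining sizes of the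
type-`j` jobs at server `m`. -/
abbrev State (S : CloudSystem I J M) : Type := Fin J → Fin M → List S.JobSize

/-- The jobs that arrive in one time slot, for every type. -/
abbrev Arrivals (S : CloudSystem I J M) : Type := Fin J → List S.JobSize

/-- The queue length (backlogged work) of type `j` at server `m`. -/
def queueLength {S : CloudSystem I J M} (Y : S.State) (j : Fin J) (m : Fin M) : ℕ := work (Y j m)

/-- The servers with the smallest queue length for type-`j` jobs. -/
def shortestQueues {S : CloudSystem I J M} (Y : S.State) (j : Fin J) : Finset (Fin M) :=
  {m | ∀ m', queueLength Y j m ≤ queueLength Y j m'}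

theorem shortestQueues_nonempty [NeZero M] {S : CloudSystem I J M} (Y : S.State) (j : Fin J) :
    (shortestQueues Y j).Nonempty := by
  obtain ⟨m, -, hm⟩ := Finset.exists_min_image Finset.univ (queueLength Y j)
    ⟨(0 : Fin M), Finset.mem_univ _⟩
  exact ⟨m, by simpa [shortestQueues] using hm⟩

/-- JSQ routing: the server chosen for the arrivals of type `j` is uniformly distributed on the
servers with the smallest type-`j` queue, independently for the different types (the uniform law on
a product of finite sets is the product of the uniform laws). -/
def jsqRouting [NeZero M] {S : CloudSystem I J M} (Y : S.State) : PMF (Fin J → Fin M) :=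
  PMF.uniformOfFinset (Fintype.piFinset (shortestQueues Y))
    (Fintype.piFinset_nonempty.2 (shortestQueues_nonempty Y))

/-- The state after the arrivals `A` have joined the servers `route j`. -/
def addArrivals {S : CloudSystem I J M} (Y : S.State) (A : S.Arrivals) (route : Fin J → Fin M) :
    S.State :=
  fun j m => Y j m ++ (if m = route j then A j else [])

/-- `s` is a MaxWeight schedule for server `m` in state `Y`: an integer point of the convex hull of
the maximal configurations which maximizes `∑ j, s j * q j m` over this hull. -/
def IsMaxWeight (S : CloudSystem I J M) (Y : S.State) (m : Fin M) (s : Fin J → ℕ) : Prop :=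
  toVec s ∈ S.hullMaximal m ∧
    ∀ x ∈ S.hullMaximal m, ∑ j, x j * (queueLength Y j m : ℝ) ≤ ∑ j, s j * (queueLength Y j m : ℝ)

/-- `L'` results from `L` when, in one time slot, `n` different jobs (all jobs, if there are fewer
than `n`) receive one unit of service each; the completed jobs leave. -/
def ServedOneSlot {S : CloudSystem I J M} (n : ℕ) (L L' : List S.JobSize) : Prop :=
  ∃ T : Multiset ℕ, T ≤ sizes L ∧ T.card = min n L.length ∧
    sizes L' = (sizes L - T) + (T.map (fun d => d - 1)).filter (fun d => 0 < d)

/-- MaxWeight scheduling. The choices that the algorithm leaves open are the data of the structure: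
`schedule` breaks ties between MaxWeight schedules, and `serve` selects (and lists) the jobs, where
both choices may be randomized. -/
structure MaxWeightPolicy (S : CloudSystem I J M) where
  schedule : S.State → PMF (Fin M → Fin J → ℕ)
  schedule_isMaxWeight : ∀ Y, ∀ s ∈ (schedule Y).support, ∀ m, S.IsMaxWeight Y m (s m)
  serve : S.State → (Fin M → Fin J → ℕ) → PMF S.State
  serve_servedOneSlot : ∀ Z s, ∀ Y' ∈ (serve Z s).support, ∀ j m,
    ServedOneSlot (s m j) (Z j m) (Y' j m)

/-- One time slot of the system under JSQ routing and MaxWeight scheduling, when the arrivals in a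
time slot have law `ν`: routing and schedule are chosen from the queue lengths at the beginning of
the slot, the arrivals join their queues, and then the jobs are served. Since the arrivals are
i.i.d. over time, the state process is the Markov chain with this transition law. -/
def step [NeZero M] (S : CloudSystem I J M) (ν : PMF S.Arrivals) (P : S.MaxWeightPolicy)
    (Y : S.State) : PMF S.State :=
  ν.bind fun A => (jsqRouting Y).bind fun route => (P.schedule Y).bind fun s =>
    P.serve (addArrivals Y A route) s

/-- `π` is a steady-state (invariant) distribution of the Markov chain `step`. -/
def IsSteadyState [NeZero M] (S : CloudSystem I J M) (ν : PMF S.Arrivals) (P : S.MaxWeightPolicy)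
    (π : PMF S.State) : Prop :=
  π.bind (S.step ν P) = π

/-- The vector of the expected amounts of work that arrive in one time slot. -/
def arrivalRate {S : CloudSystem I J M} (ν : PMF S.Arrivals) : EuclideanSpace ℝ (Fin J) :=
  WithLp.toLp 2 (fun j => ∑' A, (ν A).toReal * (work (A j) : ℝ))

/-! ### The component of the queue lengths perpendicular to a normal vector -/

/-- The vector of queue lengths in `ℝ^(JM)`. -/
def queueVec {S : CloudSystem I J M} (Y : S.State) : EuclideanSpace ℝ (Fin J × Fin M) :=
  WithLp.toLp 2 (fun x => (queueLength Y x.1 x.2 : ℝ))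

/-- The vector of `ℝ^(JM)` with entries `c j / √M`. -/
def replicate (M : ℕ) (c : EuclideanSpace ℝ (Fin J)) : EuclideanSpace ℝ (Fin J × Fin M) :=
  WithLp.toLp 2 (fun x => c x.1 / Real.sqrt M)

/-- The projection of the queue lengths on the replicated vector `c`. -/
def queuePar {S : CloudSystem I J M} (c : EuclideanSpace ℝ (Fin J)) (Y : S.State) :
    EuclideanSpace ℝ (Fin J × Fin M) :=
  inner ℝ (replicate M c) (queueVec Y) • replicate M c

/-- The component of the queue lengths perpendicular to the replicated vector `c`. -/
def queuePerp {S : CloudSystem I J M} (c : EuclideanSpace ℝ (Fin J)) (Y : S.State) :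
    EuclideanSpace ℝ (Fin J × Fin M) :=
  queueVec Y - queuePar c Y

end

end CloudSystem

/-! ### Markov chains on discrete spaces: drift conditions and invariant distributions -/

namespace PMF

variable {α β : Type*}

/-! The Lyapunov function is the norm `V` of the perpendicular queue vector. Its square is the
squared norm of all queues minus the square of the part along the replicated normal `c`, and the two
are estimated separately.

Since the servers are identical, `M` times the hull of one server dominates the capacity region, so
MaxWeight at server `m` collects at least `1/M` of the support function of the region at the row
`q_m`. The region contains a disc of some radius `δ` around `p = λ + ε c` in the hyperplane, so this
is at least `(⟨p, q_m⟩ + δ ‖w_m‖) / M`, where `w_m` is the part of `q_m` perpendicular to `c`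
(`inner_add_norm_perp_le`). JSQ adds only `∑ λ_j min_m q_{j,m}`, which falls short of uniform
routing by some `G ≥ 0`. With `a` the mean over the servers of `⟨c, q_m⟩`, the mean growth of the
squared norm is at most a constant minus `2 G + 2 (δ/M) ∑ ‖w_m‖ + 2 ε a`.

The total schedule lies in the region, so its component along `c` is at most `b`, and the squared
parallel part loses on average at most `2 ε a`. The two `ε`-terms cancel. The remaining `G` and `∑
‖w_m‖` control `V` (`norm_queuePerp_le_spread`), as long as `⟨λ, c⟩ = b - ε` stays away from 0. For
`ε ≥ b/2` the norm of all queues, which dominates `V`, already has a drift of fixed rate.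

Quadratic drift with bounded increments turns into geometric drift of `exp (θ V)`, which bounds all
moments in every invariant distribution. Existence comes from the drift of order `ε` of the full
norm, whose sublevel sets are finite. -/

theorem tsum_bind_mul (p : PMF α) (g : α → PMF β) (f : β → ℝ≥0∞) :
    ∑' b, p.bind g b * f b = ∑' a, p a * ∑' b, g a b * f b := by
  simp only [bind_apply, ← ENNReal.tsum_mul_right, ← ENNReal.tsum_mul_left]
  rw [ENNReal.tsum_comm]
  simp only [mul_assoc]

theorem tsum_mul_const (p : PMF α) (C : ℝ≥0∞) : ∑' a, p a * C = C := by
  rw [ENNReal.tsum_mul_right, p.tsum_coe, one_mul]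

theorem tsum_mul_le_of_support (p : PMF α) {f g : α → ℝ≥0∞} (h : ∀ a ∈ p.support, f a ≤ g a) :
    ∑' a, p a * f a ≤ ∑' a, p a * g a := by
  refine ENNReal.tsum_le_tsum fun a => ?_
  by_cases ha : p a = 0
  · simp [ha]
  · exact mul_le_mul_right (h a ((p.mem_support_iff a).2 ha)) _

theorem tsum_mul_le_const (p : PMF α) {f : α → ℝ≥0∞} {C : ℝ≥0∞} (h : ∀ a ∈ p.support, f a ≤ C) :
    ∑' a, p a * f a ≤ C :=
  (p.tsum_mul_le_of_support h).trans (p.tsum_mul_const C).le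

theorem tsum_mul_le_of_hasSum (p : PMF α) {f : α → ℝ≥0∞} {g : α → ℝ} {e : ℝ}
    (hfg : ∀ a ∈ p.support, f a ≤ ENNReal.ofReal (g a)) (hg : ∀ a ∈ p.support, 0 ≤ g a)
    (he : HasSum (fun a => (p a).toReal * g a) e) : ∑' a, p a * f a ≤ ENNReal.ofReal e := by
  refine (p.tsum_mul_le_of_support hfg).trans (le_of_eq ?_)
  have h0 : ∀ a, 0 ≤ (p a).toReal * g a := fun a => by
    by_cases ha : p a = 0
    · simp [ha]
    · exact mul_nonneg ENNReal.toReal_nonneg (hg a ((p.mem_support_iff a).2 ha))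
  rw [← he.tsum_eq, ENNReal.ofReal_tsum_of_nonneg h0 he.summable]
  refine tsum_congr fun a => ?_
  rw [ENNReal.ofReal_mul ENNReal.toReal_nonneg, ENNReal.ofReal_toReal (p.apply_ne_top a)]

/-- A geometric drift condition bounds the mean of the Lyapunov function in every invariant
distribution, whether or not this mean is known to be finite. -/
theorem tsum_invariant_le_of_geometric_drift {P : α → PMF α} {f : α → ℝ≥0∞}
    (hf : ∀ x, f x ≠ ∞) {ρ C : ℝ≥0} (hρ : ρ < 1)
    (hdrift : ∀ x, ∑' y, P x y * f y ≤ ρ * f x + C) {π : PMF α} (hπ : π.bind P = π) :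
    ∑' x, π x * f x ≤ ↑(C / (1 - ρ)) := by
  have hρ' : (1 - ρ) ≠ 0 := (tsub_pos_of_lt hρ).ne'
  -- The mean of `f` may be infinite, so it cannot be cancelled in the drift inequality. The mean of
  -- `min f n` is finite, and on `f ≤ n` the truncated inequality still yields the gain `(1 - ρ) f`.
  have htrunc : ∀ n : ℕ, ((1 - ρ : ℝ≥0) : ℝ≥0∞) * ∑' x, π x * (if f x ≤ n then f x else 0) ≤ C := by
    intro n
    have hinv : ∑' x, π x * min (f x) n ≤ ∑' x, π x * min (ρ * f x + C) n := by
      conv_lhs => rw [← hπ]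
      rw [tsum_bind_mul]
      refine ENNReal.tsum_le_tsum fun x => mul_le_mul_right (le_min ?_ ?_) _
      · exact (ENNReal.tsum_le_tsum fun y => mul_le_mul_right (min_le_left _ _) _).trans (hdrift x)
      · exact (P x).tsum_mul_le_const fun _ _ => min_le_right _ _
    have hfin : ∑' x, π x * min (f x) n ≠ ∞ :=
      ((π.tsum_mul_le_const fun _ _ => min_le_right _ _).trans_lt (ENNReal.natCast_lt_top n)).ne
    have hpt : ∀ x, min (ρ * f x + C) n + ((1 - ρ : ℝ≥0) : ℝ≥0∞) * (if f x ≤ n then f x else 0) ≤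
        min (f x) n + C := by
      intro x
      split_ifs with h
      · rw [min_eq_left h]
        calc min (ρ * f x + C) (n : ℝ≥0∞) + ((1 - ρ : ℝ≥0) : ℝ≥0∞) * f x
            ≤ (ρ * f x + C) + ((1 - ρ : ℝ≥0) : ℝ≥0∞) * f x := by gcongr; exact min_le_left _ _
          _ = ((ρ + (1 - ρ) : ℝ≥0) : ℝ≥0∞) * f x + C := by push_cast; ring
          _ = f x + C := by rw [add_tsub_cancel_of_le hρ.le]; simp
      · rw [min_eq_right (not_le.1 h).le, mul_zero, add_zero]
        exact (min_le_right _ _).trans le_self_add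
    have hsum : (∑' x, π x * min (f x) n) +
        ((1 - ρ : ℝ≥0) : ℝ≥0∞) * ∑' x, π x * (if f x ≤ n then f x else 0) ≤
        (∑' x, π x * min (f x) n) + C := by
      calc _ ≤ (∑' x, π x * min (ρ * f x + C) n) +
              ((1 - ρ : ℝ≥0) : ℝ≥0∞) * ∑' x, π x * (if f x ≤ n then f x else 0) := by gcongr
        _ = ∑' x, π x * (min (ρ * f x + C) n +
              ((1 - ρ : ℝ≥0) : ℝ≥0∞) * (if f x ≤ n then f x else 0)) := by
            rw [← ENNReal.tsum_mul_left, ← ENNReal.tsum_add]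
            exact tsum_congr fun x => by ring
        _ ≤ ∑' x, π x * (min (f x) n + C) :=
            ENNReal.tsum_le_tsum fun x => mul_le_mul_right (hpt x) _
        _ = _ := by simp only [mul_add, ENNReal.tsum_add, tsum_mul_const]
    exact (ENNReal.add_le_add_iff_left hfin).1 hsum
  rw [ENNReal.tsum_eq_iSup_sum]
  refine iSup_le fun s => ?_
  obtain ⟨n, hn⟩ : ∃ n : ℕ, ∀ x ∈ s, f x ≤ n := by
    choose N hN using fun x => ENNReal.exists_nat_gt (hf x)
    exact ⟨s.sup N, fun x hx => (hN x).le.trans (by exact_mod_cast Finset.le_sup hx)⟩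
  have hle : ∑ x ∈ s, π x * f x ≤ ∑' x, π x * (if f x ≤ n then f x else 0) := by
    refine le_trans (le_of_eq (Finset.sum_congr rfl fun x hx => ?_)) (ENNReal.sum_le_tsum s)
    rw [if_pos (hn x hx)]
  rw [ENNReal.coe_div hρ', ENNReal.le_div_iff_mul_le (Or.inl (by exact_mod_cast hρ')) (by simp),
    mul_comm]
  exact (mul_le_mul_right hle _).trans (htrunc n)

/-! ### Existence of invariant distributions by averaging over time. -/

/-- The law of a Markov chain after `n` steps from `x₀`. -/
noncomputable def chainLaw (P : α → PMF α) (x₀ : α) : ℕ → PMF α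
  | 0 => PMF.pure x₀
  | n + 1 => (chainLaw P x₀ n).bind P

/-- `C / (1 - ρ)` is the fixed point of `t ↦ ρ t + C`, so the bound reproduces itself from step to
step. Its uniformity in `n` provides tightness. -/
theorem chainLaw_lyapunov_le {P : α → PMF α} {f : α → ℝ≥0∞} {ρ C : ℝ≥0} (hρ : ρ < 1)
    (hdrift : ∀ x, ∑' y, P x y * f y ≤ ρ * f x + C) (x₀ : α) (n : ℕ) :
    ∑' x, chainLaw P x₀ n x * f x ≤ f x₀ + ↑(C / (1 - ρ)) := by
  have hρ' : (1 - ρ) ≠ 0 := (tsub_pos_of_lt hρ).ne'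
  induction n with
  | zero =>
    have h : ∑' x, chainLaw P x₀ 0 x * f x = f x₀ := by
      rw [tsum_eq_single x₀]
      · simp [chainLaw]
      · intro x hx
        simp [chainLaw, hx]
    rw [h]
    exact le_self_add
  | succ n ih =>
    calc ∑' x, chainLaw P x₀ (n + 1) x * f x
        = ∑' x, chainLaw P x₀ n x * ∑' y, P x y * f y := tsum_bind_mul _ _ _
      _ ≤ ∑' x, chainLaw P x₀ n x * (ρ * f x + C) :=
          ENNReal.tsum_le_tsum fun x => mul_le_mul_right (hdrift x) _
      _ = ρ * (∑' x, chainLaw P x₀ n x * f x) + C := by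
          simp only [mul_add, ENNReal.tsum_add, tsum_mul_const]
          rw [← ENNReal.tsum_mul_left]
          congr 1
          exact tsum_congr fun x => by ring
      _ ≤ ρ * (f x₀ + ↑(C / (1 - ρ))) + C := by gcongr
      _ = ρ * f x₀ + ((ρ * (C / (1 - ρ)) + C : ℝ≥0) : ℝ≥0∞) := by push_cast; ring
      _ = ρ * f x₀ + ↑(C / (1 - ρ)) := by
          congr 2
          have h1 : ρ + (1 - ρ) = 1 := add_tsub_cancel_of_le hρ.le
          calc ρ * (C / (1 - ρ)) + C = ρ * (C / (1 - ρ)) + (1 - ρ) * (C / (1 - ρ)) := by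
                rw [mul_div_cancel₀ _ hρ']
            _ = C / (1 - ρ) := by rw [← add_mul, h1, one_mul]
      _ ≤ f x₀ + ↑(C / (1 - ρ)) := by
          gcongr
          exact mul_le_of_le_one_left zero_le (by exact_mod_cast hρ.le)

/-- The average of the laws of a Markov chain over the first `n + 1` time slots. -/
noncomputable def averagedLaw (P : α → PMF α) (x₀ : α) (n : ℕ) (x : α) : ℝ≥0∞ :=
  ((n : ℝ≥0∞) + 1)⁻¹ * ∑ i ∈ Finset.range (n + 1), chainLaw P x₀ i x

theorem tsum_averagedLaw_mul (P : α → PMF α) (x₀ : α) (n : ℕ) (f : α → ℝ≥0∞) :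
    ∑' x, averagedLaw P x₀ n x * f x =
      ((n : ℝ≥0∞) + 1)⁻¹ * ∑ i ∈ Finset.range (n + 1), ∑' x, chainLaw P x₀ i x * f x := by
  simp only [averagedLaw, mul_assoc, ENNReal.tsum_mul_left, Finset.sum_mul]
  rw [Summable.tsum_finsetSum fun _ _ => ENNReal.summable]

theorem inv_mul_sum_range_le {g : ℕ → ℝ≥0∞} {B : ℝ≥0∞} (h : ∀ i, g i ≤ B) (n : ℕ) :
    ((n : ℝ≥0∞) + 1)⁻¹ * ∑ i ∈ Finset.range (n + 1), g i ≤ B := by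
  have h0 : ((n : ℝ≥0∞) + 1) ≠ 0 := by positivity
  have h1 : ((n : ℝ≥0∞) + 1) ≠ ∞ := by finiteness
  calc _ ≤ ((n : ℝ≥0∞) + 1)⁻¹ * ∑ i ∈ Finset.range (n + 1), B := by gcongr; exact h _
    _ = B := by
      rw [Finset.sum_const, Finset.card_range, nsmul_eq_mul, ← mul_assoc]
      push_cast
      rw [ENNReal.inv_mul_cancel h0 h1, one_mul]

theorem tsum_averagedLaw (P : α → PMF α) (x₀ : α) (n : ℕ) : ∑' x, averagedLaw P x₀ n x = 1 := by
  have h0 : ((n : ℝ≥0∞) + 1) ≠ 0 := by positivity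
  have h1 : ((n : ℝ≥0∞) + 1) ≠ ∞ := by finiteness
  have h := tsum_averagedLaw_mul P x₀ n 1
  simp only [Pi.one_apply, mul_one, tsum_coe, Finset.sum_const, Finset.card_range,
    nsmul_eq_mul] at h
  rw [h]
  push_cast
  exact ENNReal.inv_mul_cancel h0 h1

/-- One step of the chain shifts the time window by one slot, so only its last law, of weight `1 /
(n + 1)`, is new. In the limit this makes the averages subinvariant. -/
theorem tsum_averagedLaw_mul_kernel_le (P : α → PMF α) (x₀ : α) (n : ℕ) (y : α) :
    ∑' x, averagedLaw P x₀ n x * P x y ≤ averagedLaw P x₀ n y + ((n : ℝ≥0∞) + 1)⁻¹ := by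
  rw [tsum_averagedLaw_mul, averagedLaw]
  have h : ∑ i ∈ Finset.range (n + 1), ∑' x, chainLaw P x₀ i x * P x y ≤
      ∑ i ∈ Finset.range (n + 1), chainLaw P x₀ i y + 1 := by
    calc _ = ∑ i ∈ Finset.range (n + 1), chainLaw P x₀ (i + 1) y := rfl
      _ ≤ ∑ i ∈ Finset.range (n + 2), chainLaw P x₀ i y := by
          rw [Finset.sum_range_succ' _ (n + 1)]; exact le_self_add
      _ = ∑ i ∈ Finset.range (n + 1), chainLaw P x₀ i y + chainLaw P x₀ (n + 1) y :=
          Finset.sum_range_succ _ _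
      _ ≤ _ := by gcongr; exact coe_le_one _ _
  calc _ ≤ ((n : ℝ≥0∞) + 1)⁻¹ * (∑ i ∈ Finset.range (n + 1), chainLaw P x₀ i y + 1) := by gcongr
    _ = _ := by rw [mul_add, mul_one]

/-- A Markov chain on a discrete space that satisfies a geometric drift condition, with a Lyapunov
function whose sublevel sets are finite, has an invariant distribution. -/
theorem exists_invariant_of_geometric_drift [Nonempty α] {P : α → PMF α} {f : α → ℝ≥0∞}
    (hf : ∀ x, f x ≠ ∞) (hfin : ∀ t : ℝ≥0, {x | f x ≤ t}.Finite) {ρ C : ℝ≥0} (hρ : ρ < 1)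
    (hdrift : ∀ x, ∑' y, P x y * f y ≤ ρ * f x + C) : ∃ π : PMF α, π.bind P = π := by
  classical
  obtain ⟨x₀⟩ := ‹Nonempty α›
  set μ := averagedLaw P x₀ with hμ
  -- An ultrafilter gives pointwise limits at all states at once, by compactness of `[0, ∞]`.
  set 𝒰 : Ultrafilter ℕ := Ultrafilter.of Filter.atTop
  have h𝒰 : (𝒰 : Filter ℕ) ≤ Filter.atTop := Ultrafilter.of_le _
  have hlim : ∀ x, ∃ l : ℝ≥0∞, Filter.Tendsto (fun n => μ n x) 𝒰 (nhds l) := fun x => by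
    obtain ⟨l, -, hl⟩ := isCompact_univ.ultrafilter_le_nhds (𝒰.map fun n => μ n x) (by simp)
    exact ⟨l, hl⟩
  choose p hp using hlim
  have hle : ∑' x, p x ≤ 1 := by
    rw [ENNReal.tsum_eq_iSup_sum]
    refine iSup_le fun s => le_of_tendsto (tendsto_finsetSum s fun x _ => hp x) ?_
    exact Filter.Eventually.of_forall fun n =>
      (ENNReal.sum_le_tsum s).trans (tsum_averagedLaw P x₀ n).le
  obtain ⟨B, hB⟩ : ∃ B : ℝ≥0, ∀ n, ∑' x, μ n x * f x ≤ B := by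
    refine ⟨(f x₀).toNNReal + C / (1 - ρ), fun n => ?_⟩
    rw [ENNReal.coe_add, ENNReal.coe_toNNReal (hf x₀), hμ, tsum_averagedLaw_mul]
    exact inv_mul_sum_range_le (chainLaw_lyapunov_le hρ hdrift x₀) n
  -- No mass escapes to infinity: by Markov's inequality each average has mass at most `B / t`
  -- outside the finite set `f ≤ t`.
  have hge : 1 ≤ ∑' x, p x := by
    have hbound : ∀ t : ℕ, (t : ℝ≥0∞) ≤ t * ∑' x, p x + B := by
      intro t
      have hF : {x | f x ≤ t}.Finite := by simpa using hfin (t : ℝ≥0)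
      have hev : ∀ n, (t : ℝ≥0∞) ≤ t * ∑ x ∈ hF.toFinset, μ n x + B := by
        intro n
        calc (t : ℝ≥0∞) = ∑' x, μ n x * t := by
              rw [ENNReal.tsum_mul_right, hμ, tsum_averagedLaw, one_mul]
          _ ≤ ∑' x, ((if x ∈ hF.toFinset then t * μ n x else 0) + μ n x * f x) := by
              refine ENNReal.tsum_le_tsum fun x => ?_
              by_cases hx : f x ≤ t
              · rw [if_pos (by simpa using hx), mul_comm]; exact le_self_add
              · exact (mul_le_mul_right (not_le.1 hx).le _).trans le_add_self
          _ = t * ∑ x ∈ hF.toFinset, μ n x + ∑' x, μ n x * f x := by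
              rw [ENNReal.tsum_add, Finset.mul_sum, tsum_eq_sum (s := hF.toFinset)]
              · congr 1
                exact Finset.sum_congr rfl fun x hx => if_pos hx
              · intro x hx
                exact if_neg hx
          _ ≤ _ := by gcongr; exact hB n
      have hlim : Filter.Tendsto (fun n => t * ∑ x ∈ hF.toFinset, μ n x + B) 𝒰
          (nhds (t * ∑ x ∈ hF.toFinset, p x + B)) :=
        (ENNReal.Tendsto.const_mul (tendsto_finsetSum _ fun x _ => hp x)
          (Or.inr (ENNReal.natCast_ne_top t))).add tendsto_const_nhds
      refine (ge_of_tendsto hlim (Filter.Eventually.of_forall hev)).trans ?_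
      gcongr
      exact ENNReal.sum_le_tsum _
    have hne : ∑' x, p x ≠ ∞ := (hle.trans_lt ENNReal.one_lt_top).ne
    lift ∑' x, p x to ℝ≥0 using hne with z
    by_contra! hlt
    have hlt' : (z : ℝ) < 1 := by exact_mod_cast hlt
    obtain ⟨t, ht⟩ := exists_nat_gt ((B : ℝ) / (1 - z))
    rw [div_lt_iff₀ (by linarith)] at ht
    have := hbound t
    have h2 : (t : ℝ) ≤ t * z + B := by exact_mod_cast this
    nlinarith
  have hsum : ∑' x, p x = 1 := le_antisymm hle hge
  have hsub : ∀ y, ∑' x, p x * P x y ≤ p y := by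
    intro y
    have hinv : Filter.Tendsto (fun n : ℕ => ((n : ℝ≥0∞) + 1)⁻¹) 𝒰 (nhds 0) := by
      have h := (Filter.tendsto_add_atTop_iff_nat 1).2 ENNReal.tendsto_inv_nat_nhds_zero
      push_cast at h
      exact h.mono_left h𝒰
    rw [ENNReal.tsum_eq_iSup_sum]
    refine iSup_le fun s => ?_
    have h1 : Filter.Tendsto (fun n => ∑ x ∈ s, μ n x * P x y) 𝒰
        (nhds (∑ x ∈ s, p x * P x y)) :=
      tendsto_finsetSum s fun x _ =>
        ENNReal.Tendsto.mul_const (hp x) (Or.inr ((P x).apply_ne_top y))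
    have h2 := (hp y).add hinv
    rw [add_zero] at h2
    exact le_of_tendsto_of_tendsto' h1 h2 fun n =>
      (ENNReal.sum_le_tsum s).trans (tsum_averagedLaw_mul_kernel_le P x₀ n y)
  set π : PMF α := ⟨p, hsum ▸ ENNReal.summable.hasSum⟩ with hπ
  refine ⟨π, PMF.ext fun y => ?_⟩
  rw [bind_apply]
  have hy : ∑' x, π x * P x y ≤ π y := hsub y
  refine le_antisymm hy ?_
  -- A subinvariant probability is invariant, because a strict inequality at one state would lower
  -- the total mass.
  by_contra! hlt
  have h1 : ∑' z, (π.bind P) z < ∑' z, π z := by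
    refine ENNReal.tsum_lt_tsum (i := y) ?_ (fun z => ?_) ?_
    · rw [tsum_coe]; exact ENNReal.one_ne_top
    · rw [bind_apply]; exact hsub z
    · rw [bind_apply]; exact hlt
  rw [tsum_coe, tsum_coe] at h1
  exact lt_irrefl _ h1

/-! ### From quadratic drift to exponential moments. -/

/-- A Markov chain that moves from `x` by first drawing `A` with law `ν` and then the new state with
law `κ x A` has negative quadratic drift outside of a bounded set: `V` has bounded increments,
`V ^ 2` grows by at most `F x A`, and the mean of `F x A` is at most `K - 2 η V x`. -/
structure QuadraticDrift (ν : PMF β) (κ : α → β → PMF α) (V : α → ℝ) (F : α → β → ℝ)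
    (D K η : ℝ) : Prop where
  nonneg : ∀ x, 0 ≤ V x
  abs_sub_le : ∀ x, ∀ A ∈ ν.support, ∀ y ∈ (κ x A).support, |V y - V x| ≤ D
  sq_le : ∀ x, ∀ A ∈ ν.support, ∀ y ∈ (κ x A).support, V y ^ 2 ≤ V x ^ 2 + F x A
  mean_le : ∀ x, ∃ e, HasSum (fun A => (ν A).toReal * F x A) e ∧ e ≤ K - 2 * η * V x

theorem hasSum_toReal (ν : PMF β) : HasSum (fun A => (ν A).toReal) 1 := by
  have h := ENNReal.hasSum_toReal (f := ν) (by rw [tsum_coe]; exact ENNReal.one_ne_top)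
  rwa [← ENNReal.tsum_toReal_eq ν.apply_ne_top, tsum_coe, ENNReal.toReal_one] at h

namespace QuadraticDrift

/-- The exponent of the exponential Lyapunov function. -/
noncomputable def exponent (D η : ℝ) : ℝ := min (1 / D) (η / (4 * D ^ 2))

/-- The contraction factor in the geometric drift condition. -/
noncomputable def contraction (D η : ℝ) : ℝ≥0 := (1 - exponent D η * η / 4).toNNReal

/-- The additive constant in the geometric drift condition. -/
noncomputable def constant (D K η : ℝ) : ℝ≥0 := (Real.exp (exponent D η * (K / η + D))).toNNReal

theorem exponent_pos {D η : ℝ} (hD : 0 < D) (hη : 0 < η) : 0 < exponent D η :=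
  lt_min (by positivity) (by positivity)

theorem contraction_lt_one {D η : ℝ} (hD : 0 < D) (hη : 0 < η) : contraction D η < 1 := by
  have := exponent_pos hD hη
  rw [contraction, Real.toNNReal_lt_one]
  have : 0 < exponent D η * η := by positivity
  linarith

variable {ν : PMF β} {κ : α → β → PMF α} {V : α → ℝ} {F : α → β → ℝ} {D K η : ℝ}

theorem geometric (h : QuadraticDrift ν κ V F D K η) (hD : 0 < D) (hK : 0 ≤ K) (hη : 0 < η)
    (x : α) :
    ∑' y, (ν.bind (κ x)) y * ENNReal.ofReal (Real.exp (exponent D η * V y)) ≤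
      contraction D η * ENNReal.ofReal (Real.exp (exponent D η * V x)) + constant D K η := by
  set θ := exponent D η with hθdef
  have hθ : 0 < θ := exponent_pos hD hη
  have hθD : θ * D ≤ 1 := by
    have : θ ≤ 1 / D := min_le_left _ _
    rwa [le_div_iff₀ hD] at this
  have hθD2 : θ * D ^ 2 ≤ η / 4 := by
    have : θ ≤ η / (4 * D ^ 2) := min_le_right _ _
    rw [le_div_iff₀ (by positivity)] at this
    linarith
  rw [tsum_bind_mul]
  rcases le_or_gt (V x) (K / η) with hV | hV
  -- For small `V x` the increment bound alone suffices; this is the origin of `constant`.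
  · refine le_add_left (ν.tsum_mul_le_const fun A hA => (κ x A).tsum_mul_le_const fun y hy => ?_)
    rw [constant, ← ENNReal.ofReal]
    refine ENNReal.ofReal_le_ofReal (Real.exp_le_exp.2 ?_)
    have := (abs_le.1 (h.abs_sub_le x A hA y hy)).2
    gcongr
    linarith
  · refine le_add_right ?_
    have hV0 : 0 < V x := (div_nonneg hK hη.le).trans_lt hV
    obtain ⟨e, he, hele⟩ := h.mean_le x
    -- Expand `exp (θ (V y - V x))` to second order, with `V y - V x ≤ F / (2 V x)` obtained by
    -- dropping the square of the increment. The quadratic term costs at most `θ η / 4`; since `K <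
    -- η V x`, the linear term gains `θ η / 2` on average, which leaves `contraction`.
    have hpt : ∀ A ∈ ν.support, ∀ y ∈ (κ x A).support, Real.exp (θ * V y) ≤
        Real.exp (θ * V x) * (1 + θ ^ 2 * D ^ 2) + Real.exp (θ * V x) * (θ / (2 * V x)) * F x A := by
      intro A hA y hy
      have hd := h.abs_sub_le x A hA y hy
      have hsq := h.sq_le x A hA y hy
      have hx1 : |θ * (V y - V x)| ≤ 1 := by
        rw [abs_mul, abs_of_pos hθ]
        exact (mul_le_mul_of_nonneg_left hd hθ.le).trans hθD
      have hexp := (abs_le.1 (Real.abs_exp_sub_one_sub_id_le hx1)).2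
      have hlin : V y - V x ≤ F x A / (2 * V x) := by
        rw [le_div_iff₀ (by positivity)]
        nlinarith [sq_nonneg (V y - V x)]
      have hsq' : (V y - V x) ^ 2 ≤ D ^ 2 := by
        rw [← sq_abs]
        exact pow_le_pow_left₀ (abs_nonneg _) hd 2
      have e1 : Real.exp (θ * V y) = Real.exp (θ * V x) * Real.exp (θ * (V y - V x)) := by
        rw [← Real.exp_add]; ring_nf
      rw [e1, mul_assoc, ← mul_add]
      refine mul_le_mul_of_nonneg_left ?_ (Real.exp_pos _).le
      have h1 : θ * (V y - V x) ≤ θ / (2 * V x) * F x A := by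
        calc _ ≤ θ * (F x A / (2 * V x)) := by gcongr
          _ = _ := by ring
      have h2 : (θ * (V y - V x)) ^ 2 ≤ θ ^ 2 * D ^ 2 := by
        rw [mul_pow]; gcongr
      linarith
    have hG : HasSum (fun A => (ν A).toReal * (Real.exp (θ * V x) * (1 + θ ^ 2 * D ^ 2) +
        Real.exp (θ * V x) * (θ / (2 * V x)) * F x A))
        (Real.exp (θ * V x) * (1 + θ ^ 2 * D ^ 2) + Real.exp (θ * V x) * (θ / (2 * V x)) * e) := by
      have h1 := (ν.hasSum_toReal.mul_right (Real.exp (θ * V x) * (1 + θ ^ 2 * D ^ 2))).add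
        (he.mul_left (Real.exp (θ * V x) * (θ / (2 * V x))))
      rw [one_mul] at h1
      refine Eq.subst (motive := fun f => HasSum f _) (funext fun A => ?_) h1
      ring
    refine (ν.tsum_mul_le_of_hasSum (fun A hA => (κ x A).tsum_mul_le_const fun y hy =>
      ENNReal.ofReal_le_ofReal (hpt A hA y hy)) (fun A hA => ?_) hG).trans ?_
    · obtain ⟨y, hy⟩ := (κ x A).support_nonempty
      exact (Real.exp_pos _).le.trans (hpt A hA y hy)
    · rw [contraction, ← ENNReal.ofReal, ← hθdef]
      rcases le_or_gt 0 (1 - θ * η / 4) with hc | hc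
      · rw [← ENNReal.ofReal_mul hc]
        refine ENNReal.ofReal_le_ofReal ?_
        rw [mul_assoc, ← mul_add, mul_comm _ (Real.exp _)]
        refine mul_le_mul_of_nonneg_left ?_ (Real.exp_pos _).le
        have h1 : θ / (2 * V x) * e ≤ - (θ * η / 2) := by
          rw [div_mul_eq_mul_div, div_le_iff₀ (by positivity)]
          have : K < η * V x := by rwa [div_lt_iff₀ hη, mul_comm] at hV
          nlinarith
        nlinarith
      -- Here `contraction` is truncated to 0, and the same estimate makes the real upper bound
      -- nonpositive.
      · refine (ENNReal.ofReal_of_nonpos ?_).trans_le zero_le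
        rw [mul_assoc, ← mul_add]
        refine mul_nonpos_of_nonneg_of_nonpos (Real.exp_pos _).le ?_
        have h1 : θ / (2 * V x) * e ≤ - (θ * η / 2) := by
          rw [div_mul_eq_mul_div, div_le_iff₀ (by positivity)]
          have : K < η * V x := by rwa [div_lt_iff₀ hη, mul_comm] at hV
          nlinarith
        nlinarith

/-- The bound for the `r`-th moment of `V`. -/
noncomputable def momentBound (D K η : ℝ) (r : ℕ) : ℝ≥0 :=
  (r.factorial / exponent D η ^ r).toNNReal * (constant D K η / (1 - contraction D η))

/-- The exponential series gives `V ^ r ≤ r! / θ ^ r * exp (θ V)`, so the geometric drift of `exp (θ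
V)` bounds all moments in terms of `D`, `K` and `η` only. -/
theorem moment_le (h : QuadraticDrift ν κ V F D K η) (hD : 0 < D) (hK : 0 ≤ K) (hη : 0 < η)
    {π : PMF α} (hπ : (π.bind fun x => ν.bind (κ x)) = π) (r : ℕ) :
    ∑' x, π x * ENNReal.ofReal (V x ^ r) ≤ momentBound D K η r := by
  have hθ := exponent_pos hD hη
  have hmain := tsum_invariant_le_of_geometric_drift (fun x => ENNReal.ofReal_ne_top)
    (contraction_lt_one hD hη) (h.geometric hD hK hη) hπ
  rw [momentBound, ENNReal.coe_mul, ← ENNReal.ofReal]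
  refine le_trans ?_ (mul_le_mul_right hmain _)
  rw [← ENNReal.tsum_mul_left]
  refine ENNReal.tsum_le_tsum fun x => ?_
  rw [mul_left_comm, ← ENNReal.ofReal_mul (by positivity)]
  refine mul_le_mul_right (ENNReal.ofReal_le_ofReal ?_) _
  have hexp := Real.pow_div_factorial_le_exp (x := exponent D η * V x)
    (mul_nonneg hθ.le (h.nonneg x)) r
  rw [mul_pow, div_le_iff₀ (by positivity)] at hexp
  rw [div_mul_eq_mul_div, le_div_iff₀ (by positivity)]
  linarith

theorem exists_invariant [Nonempty α] (h : QuadraticDrift ν κ V F D K η) (hD : 0 < D) (hK : 0 ≤ K)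
    (hη : 0 < η) (hfin : ∀ t : ℝ, {x | V x ≤ t}.Finite) :
    ∃ π : PMF α, (π.bind fun x => ν.bind (κ x)) = π := by
  have hθ := exponent_pos hD hη
  refine exists_invariant_of_geometric_drift (fun x => ENNReal.ofReal_ne_top) (fun t => ?_)
    (contraction_lt_one hD hη) (h.geometric hD hK hη)
  refine (hfin (t / exponent D η)).subset fun x hx => ?_
  have h1 : Real.exp (exponent D η * V x) ≤ t := by
    have h2 : ENNReal.ofReal (Real.exp (exponent D η * V x)) ≤ (t : ℝ≥0∞) := hx
    rwa [← ENNReal.ofReal_coe_nnreal, ENNReal.ofReal_le_ofReal_iff t.coe_nonneg] at h2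
  have h3 := Real.add_one_le_exp (exponent D η * V x)
  show V x ≤ t / exponent D η
  rw [le_div_iff₀ hθ]
  linarith

end QuadraticDrift

end PMF

namespace CloudSystem
variable {I J M : ℕ}

/-! ### Geometry of the capacity region -/

theorem inner_eq_sum (x y : EuclideanSpace ℝ (Fin J)) : inner ℝ x y = ∑ j, x j * y j := by
  simp [PiLp.inner_apply, mul_comm]

/-! ### Facets and their relative interiors. -/

section Facet

variable {S : CloudSystem I J M} {K : ℕ} {c : Fin K → EuclideanSpace ℝ (Fin J)} {b : Fin K → ℝ}

theorem IsBoundedBy.mem_iff (hcb : S.IsBoundedBy c b) {x : EuclideanSpace ℝ (Fin J)} :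
    x ∈ S.capacityRegion ↔ (∀ j, 0 ≤ x j) ∧ ∀ k, inner ℝ (c k) x ≤ b k := by
  rw [hcb.region_eq]; rfl

theorem IsBoundedBy.strict_of_mem_interior (hcb : S.IsBoundedBy c b)
    {x : EuclideanSpace ℝ (Fin J)} (hx : x ∈ interior S.capacityRegion) :
    (∀ j, 0 < x j) ∧ ∀ k, inner ℝ (c k) x < b k := by
  obtain ⟨r, hr, hball⟩ := Metric.mem_nhds_iff.1 (mem_interior_iff_mem_nhds.1 hx)
  constructor
  · intro j
    have hmem : x - (r / 2) • EuclideanSpace.single j (1 : ℝ) ∈ S.capacityRegion := by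
      apply hball
      rw [Metric.mem_ball, dist_eq_norm, sub_sub_cancel_left, norm_neg, norm_smul,
        PiLp.norm_single]
      simp only [Real.norm_eq_abs, abs_one, mul_one]
      rw [abs_of_pos (by positivity)]
      linarith
    have := (hcb.mem_iff.1 hmem).1 j
    simp at this
    linarith
  · intro k
    have hmem : x + (r / 2) • c k ∈ S.capacityRegion := by
      apply hball
      rw [Metric.mem_ball, dist_eq_norm, add_sub_cancel_left, norm_smul, hcb.norm_eq_one,
        Real.norm_eq_abs, abs_of_pos (by positivity)]
      linarith
    have := (hcb.mem_iff.1 hmem).2 k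
    rw [inner_add_right, inner_smul_right, real_inner_self_eq_norm_sq, hcb.norm_eq_one] at this
    linarith

/-- Needed later to keep `⟨λ, c⟩ = b - ε` bounded away from 0 for small `ε`. -/
theorem IsBoundedBy.offset_pos (hcb : S.IsBoundedBy c b)
    (hint : (interior S.capacityRegion).Nonempty) (k : Fin K) : 0 < b k := by
  obtain ⟨x, hx⟩ := hint
  obtain ⟨h0, h1⟩ := hcb.strict_of_mem_interior hx
  refine lt_of_le_of_lt ?_ (h1 k)
  rw [inner_eq_sum]
  exact Finset.sum_nonneg fun j _ => mul_nonneg (hcb.normal_nonneg k j) (h0 j).le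

/-- The hyperplane `k` contains a point at which no other constraint is tight. -/
theorem IsBoundedBy.exists_facet_point (hcb : S.IsBoundedBy c b)
    (hint : (interior S.capacityRegion).Nonempty) (k : Fin K) :
    ∃ z, inner ℝ (c k) z = b k ∧ (∀ j, 0 < z j) ∧ ∀ l, l ≠ k → inner ℝ (c l) z < b l := by
  obtain ⟨x, hx⟩ := hint
  obtain ⟨h0, h1⟩ := hcb.strict_of_mem_interior hx
  -- Irredundance provides a point `y` that violates constraint `k` only. The segment to `y` from
  -- the interior point `x` crosses hyperplane `k` at parameter `τ`, where all other constraints are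
  -- still strict.
  obtain ⟨y, hy0, hyl, hyk⟩ : ∃ y : EuclideanSpace ℝ (Fin J), (∀ j, 0 ≤ y j) ∧
      (∀ l, l ≠ k → inner ℝ (c l) y ≤ b l) ∧ b k < inner ℝ (c k) y := by
    by_contra! hcon
    refine hcb.irredundant k (Set.Subset.antisymm ?_ ?_)
    · intro y hy
      exact ⟨(hcb.mem_iff.1 hy).1, fun l _ => (hcb.mem_iff.1 hy).2 l⟩
    · rintro y ⟨hy, hyl⟩
      refine hcb.mem_iff.2 ⟨hy, fun l => ?_⟩
      by_cases hl : l = k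
      · subst hl; exact hcon y hy hyl
      · exact hyl l hl
  have hxk := h1 k
  have hden : 0 < inner ℝ (c k) y - inner ℝ (c k) x := by linarith
  set τ := (b k - inner ℝ (c k) x) / (inner ℝ (c k) y - inner ℝ (c k) x) with hτ
  have hτ0 : 0 < τ := div_pos (by linarith) hden
  have hτ1 : τ < 1 := by rw [hτ, div_lt_one hden]; linarith
  have hin : ∀ l, inner ℝ (c l) ((1 - τ) • x + τ • y) =
      (1 - τ) * inner ℝ (c l) x + τ * inner ℝ (c l) y := fun l => by
    rw [inner_add_right, inner_smul_right, inner_smul_right]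
  refine ⟨(1 - τ) • x + τ • y, ?_, fun j => ?_, fun l hl => ?_⟩
  · have h : τ * (inner ℝ (c k) y - inner ℝ (c k) x) = b k - inner ℝ (c k) x :=
      div_mul_cancel₀ _ hden.ne'
    rw [hin]; linarith
  · simp only [PiLp.add_apply, PiLp.smul_apply, smul_eq_mul]
    have := mul_pos (sub_pos.2 hτ1) (h0 j)
    have := mul_nonneg hτ0.le (hy0 j)
    linarith
  · rw [hin]
    have := mul_lt_mul_of_pos_left (h1 l) (sub_pos.2 hτ1)
    have := mul_le_mul_of_nonneg_left (hyl l hl) hτ0.le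
    linarith

/-- Each bounding hyperplane is the affine span of its face. -/
theorem IsBoundedBy.mem_affineSpan_face (hcb : S.IsBoundedBy c b)
    (hint : (interior S.capacityRegion).Nonempty) (k : Fin K) {y : EuclideanSpace ℝ (Fin J)}
    (hy : inner ℝ (c k) y = b k) :
    y ∈ affineSpan ℝ (S.capacityRegion ∩ hyperplane (c k) (b k)) := by
  obtain ⟨z, hzk, hz0, hzl⟩ := hcb.exists_facet_point hint k
  -- Near the facet point `z` the line from `z` to `y` stays in the face; two of its points there
  -- span a line through `y`.
  have hopen : ∀ᶠ t in nhds (0 : ℝ), (∀ j, 0 < (z + t • (y - z)) j) ∧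
      ∀ l, l ≠ k → inner ℝ (c l) (z + t • (y - z)) < b l := by
    refine (Filter.eventually_all.2 fun j => ?_).and (Filter.eventually_all.2 fun l => ?_)
    · have hc : Continuous fun t : ℝ => (z + t • (y - z)) j := by
        simp only [PiLp.add_apply, PiLp.smul_apply, smul_eq_mul]; fun_prop
      exact hc.continuousAt.eventually (lt_mem_nhds (by simpa using hz0 j))
    · by_cases hl : l = k
      · exact Filter.Eventually.of_forall fun _ h => absurd hl h
      · have hc : Continuous fun t : ℝ => inner ℝ (c l) (z + t • (y - z)) := by fun_prop
        filter_upwards [hc.continuousAt.eventually (gt_mem_nhds (by simpa using hzl l hl))]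
          with t ht _ using ht
  have hface : ∀ t : ℝ, ((∀ j, 0 < (z + t • (y - z)) j) ∧
      ∀ l, l ≠ k → inner ℝ (c l) (z + t • (y - z)) < b l) →
      z + t • (y - z) ∈ S.capacityRegion ∩ hyperplane (c k) (b k) := by
    rintro t ⟨h0, hl⟩
    have hk : inner ℝ (c k) (z + t • (y - z)) = b k := by
      rw [inner_add_right, inner_smul_right, inner_sub_right, hy, hzk]; ring
    refine ⟨hcb.mem_iff.2 ⟨fun j => (h0 j).le, fun l => ?_⟩, hk⟩
    by_cases h : l = k
    · rw [h, hk]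
    · exact (hl l h).le
  obtain ⟨r, hr, hball⟩ := Metric.mem_nhds_iff.1 hopen
  have hz : z ∈ S.capacityRegion ∩ hyperplane (c k) (b k) := by
    simpa using hface 0 (hball (Metric.mem_ball_self hr))
  have hw := hface (r / 2) (hball (by
    rw [Metric.mem_ball, dist_zero_right, Real.norm_eq_abs, abs_of_pos (by positivity)]
    linarith))
  have hline := AffineMap.lineMap_mem (2 / r) (subset_affineSpan ℝ _ hz)
    (subset_affineSpan ℝ _ hw)
  rw [AffineMap.lineMap_apply] at hline
  simp only [vsub_eq_sub, vadd_eq_add, add_sub_cancel_left, smul_smul] at hline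
  have h2 : 2 / r * (r / 2) = 1 := by field_simp
  rwa [h2, one_smul, sub_add_cancel] at hline

/-- The affine span of the face is the entire hyperplane, so the relative interior is the interior
within the hyperplane. This yields the radius `δ` of the drift estimates. -/
theorem IsBoundedBy.exists_ball_subset_face (hcb : S.IsBoundedBy c b)
    (hint : (interior S.capacityRegion).Nonempty) (k : Fin K) {p : EuclideanSpace ℝ (Fin J)}
    (hp : p ∈ intrinsicInterior ℝ (S.capacityRegion ∩ hyperplane (c k) (b k))) :
    ∃ δ > 0, ∀ y, inner ℝ (c k) y = b k → ‖y - p‖ ≤ δ → y ∈ S.capacityRegion := by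
  obtain ⟨p', hp', rfl⟩ := mem_intrinsicInterior.1 hp
  obtain ⟨r, hr, hball⟩ := Metric.mem_nhds_iff.1 (mem_interior_iff_mem_nhds.1 hp')
  refine ⟨r / 2, by positivity, fun y hy hdist => ?_⟩
  have hmem : (⟨y, hcb.mem_affineSpan_face hint k hy⟩ :
      affineSpan ℝ (S.capacityRegion ∩ hyperplane (c k) (b k))) ∈ Metric.ball p' r := by
    rw [Metric.mem_ball, Subtype.dist_eq, dist_eq_norm]
    exact hdist.trans_lt (by linarith)
  exact (hball hmem).1

end Facet

/-! ### Identical servers and bounded schedules. -/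

section Hull

variable {S : CloudSystem I J M}

theorem hullMaximal_eq (hident : ∃ R₀ : Fin I → ℝ≥0, ∀ i m, S.R i m = R₀ i) (m m' : Fin M) :
    S.hullMaximal m = S.hullMaximal m' := by
  obtain ⟨R₀, hR⟩ := hident
  simp only [hullMaximal, Maximal, Feasible, hR]

/-- For identical servers, every point of the capacity region is dominated by `M` times a point of
the hull of the maximal configurations of each server. -/
theorem exists_hullMaximal_ge [NeZero M] (hident : ∃ R₀ : Fin I → ℝ≥0, ∀ i m, S.R i m = R₀ i)
    {y : EuclideanSpace ℝ (Fin J)} (hy : y ∈ S.capacityRegion) (m : Fin M) :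
    ∃ x ∈ S.hullMaximal m, ∀ j, y j ≤ M * x j := by
  obtain ⟨-, t, ht, hle⟩ := hy
  choose t' ht' htt' using fun m => (ht m).2
  have hM : (0 : ℝ) < M := by exact_mod_cast NeZero.pos M
  -- All servers share one hull, so the average of the points chosen for the servers lies in it.
  refine ⟨∑ m', (1 / (M : ℝ)) • t' m', ?_, fun j => ?_⟩
  · refine (convex_convexHull ℝ _).sum_mem (fun _ _ => by positivity) ?_ fun m' _ => ?_
    · simp [hM.ne']
    · have := ht' m'
      rwa [hullMaximal_eq hident m' m] at this
  · refine (hle j).trans ((Finset.sum_le_sum fun m' _ => htt' m' j).trans (le_of_eq ?_))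
    simp only [WithLp.ofLp_sum, Finset.sum_apply, PiLp.smul_apply, smul_eq_mul, Finset.mul_sum]
    exact Finset.sum_congr rfl fun m' _ => by field_simp

/-- If a maximal configuration exists, every job type needs some resource, for otherwise one more
job would fit. That resource bounds the coordinate, and the bound passes to the convex hull. -/
theorem exists_schedule_bound (S : CloudSystem I J M) :
    ∃ B : ℕ, ∀ m (s : Fin J → ℕ), toVec s ∈ S.hullMaximal m → ∀ j, s j ≤ B := by
  have hex : ∀ m j, ∃ B : ℕ, ∀ x ∈ S.hullMaximal m, x j ≤ B := by
    intro m j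
    by_cases hne : ∃ s, S.Maximal m s
    · obtain ⟨s₀, hfeas, hmax⟩ := hne
      have hi : ∃ i, 0 < S.r i j := by
        by_contra! hcon
        refine hmax j fun i => le_trans (le_of_eq ?_) (hfeas i)
        refine Finset.sum_congr rfl fun j' _ => ?_
        by_cases hj : j' = j
        · subst hj
          simp [le_antisymm (hcon i) (zero_le)]
        · simp [hj]
      obtain ⟨i, hi⟩ := hi
      obtain ⟨B, hB⟩ := exists_nat_ge ((S.R i m : ℝ) / S.r i j)
      refine ⟨B, fun x hx => ?_⟩
      have hconv : Convex ℝ {x : EuclideanSpace ℝ (Fin J) | x j ≤ B} :=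
        convex_halfSpace_le (f := fun x : EuclideanSpace ℝ (Fin J) => x j)
          ⟨fun _ _ => rfl, fun _ _ => rfl⟩ _
      refine convexHull_min ?_ hconv hx
      rintro _ ⟨s, hs, rfl⟩
      show (s j : ℝ) ≤ B
      refine le_trans ?_ hB
      rw [le_div_iff₀ (by exact_mod_cast hi)]
      have h1 := (Finset.single_le_sum (f := fun j => (s j : ℝ≥0) * S.r i j)
        (fun _ _ => zero_le) (Finset.mem_univ j)).trans (hs.1 i)
      exact_mod_cast h1
    · have hempty : {s | S.Maximal m s} = ∅ :=
        Set.eq_empty_iff_forall_notMem.2 fun s hs => hne ⟨s, hs⟩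
      exact ⟨0, fun x hx => by simp [hullMaximal, hempty] at hx⟩
  choose B hB using hex
  refine ⟨Finset.univ.sup fun x : Fin M × Fin J => B x.1 x.2, fun m s hs j => ?_⟩
  have h1 : (s j : ℝ) ≤ B m j := hB m j _ hs
  exact (Nat.cast_le.1 h1).trans
    (Finset.le_sup (f := fun x : Fin M × Fin J => B x.1 x.2) (Finset.mem_univ (m, j)))

theorem sum_toVec_mem_capacityRegion {s : Fin M → Fin J → ℕ}
    (hs : ∀ m, toVec (s m) ∈ S.hullMaximal m) : ∑ m, toVec (s m) ∈ S.capacityRegion := by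
  have h : ∀ j, (∑ m, toVec (s m)) j = ∑ m, (s m j : ℝ) := fun j => by
    simp [WithLp.ofLp_sum, toVec]
  refine ⟨fun j => ?_, fun m => toVec (s m), fun m => ⟨fun j => ?_, _, hs m, fun j => le_rfl⟩,
    fun j => ?_⟩
  · rw [h]; positivity
  · simp [toVec]
  · rw [h]; exact le_of_eq rfl

end Hull

/-! ### One time slot -/

section Dynamics

variable {S : CloudSystem I J M}

theorem work_append (L L' : List S.JobSize) : work (L ++ L') = work L + work L' := by
  simp [work, sizes]

theorem work_le (L : List S.JobSize) : work L ≤ S.Dmax * L.length := by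
  have h := Multiset.sum_le_card_nsmul (sizes L) S.Dmax (by
    intro x hx
    simp only [sizes, Multiset.mem_coe, List.mem_map] at hx
    obtain ⟨d, -, rfl⟩ := hx
    exact d.2.2)
  simpa [work, sizes, mul_comm] using h

theorem length_le_work (L : List S.JobSize) : L.length ≤ work L := by
  have h := Multiset.card_nsmul_le_sum (s := sizes L) (a := 1) (by
    intro x hx
    simp only [sizes, Multiset.mem_coe, List.mem_map] at hx
    obtain ⟨d, -, rfl⟩ := hx
    exact d.2.1)
  simpa [work, sizes] using h

theorem sum_map_pred_add_card (T : Multiset ℕ) (hT : ∀ d ∈ T, 1 ≤ d) :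
    (T.map fun d => d - 1).sum + T.card = T.sum := by
  induction T using Multiset.induction_on with
  | empty => simp
  | cons a T ih =>
    have ha := hT a (Multiset.mem_cons_self a T)
    have := ih fun d hd => hT d (Multiset.mem_cons_of_mem hd)
    simp only [Multiset.map_cons, Multiset.sum_cons, Multiset.card_cons]
    omega

theorem sum_filter_pos (T : Multiset ℕ) : (T.filter fun d => 0 < d).sum = T.sum := by
  induction T using Multiset.induction_on with
  | empty => simp
  | cons a T ih =>
    rcases Nat.eq_zero_or_pos a with rfl | ha
    · simpa using ih
    · rw [Multiset.filter_cons_of_pos (p := fun d => 0 < d) _ ha, Multiset.sum_cons,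
        Multiset.sum_cons, ih]

/-- The amount of work that is completed in one time slot. -/
theorem ServedOneSlot.work_add {n : ℕ} {L L' : List S.JobSize} (h : ServedOneSlot n L L') :
    work L' + min n L.length = work L := by
  obtain ⟨T, hT, hcard, hL'⟩ := h
  have hpos : ∀ d ∈ T, 1 ≤ d := fun d hd => by
    have := Multiset.mem_of_le hT hd
    simp only [sizes, Multiset.mem_coe, List.mem_map] at this
    obtain ⟨d, -, rfl⟩ := this
    exact d.2.1
  have h1 := sum_map_pred_add_card T hpos
  have h2 : (sizes L - T).sum + T.sum = (sizes L).sum := by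
    rw [← Multiset.sum_add, tsub_add_cancel_of_le hT]
  rw [work, hL', Multiset.sum_add, sum_filter_pos, work]
  omega

/-- The evolution of one queue in one time slot. -/
theorem queue_step {q q' a n len Dmax B : ℕ} {Amax : ℝ} (h : q' + min n len = q + a)
    (hlen : q + a ≤ Dmax * len) (hn : n ≤ B) (ha : (a : ℝ) ≤ Amax) :
    |(q' : ℝ) - q| ≤ Amax + B ∧ (a : ℝ) - n ≤ (q' : ℝ) - q ∧
    (q' : ℝ) ^ 2 ≤ q ^ 2 + 2 * (q * (a - n)) + (2 * (Dmax * B * B) + (Amax + B) ^ 2) := by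
  have h' : (q' : ℝ) + (min n len : ℕ) = q + a := by exact_mod_cast h
  have hmin : ((min n len : ℕ) : ℝ) ≤ n := by exact_mod_cast min_le_left n len
  have hmin0 : (0 : ℝ) ≤ (min n len : ℕ) := Nat.cast_nonneg _
  have hnB : (n : ℝ) ≤ B := by exact_mod_cast hn
  have ha0 : (0 : ℝ) ≤ a := Nat.cast_nonneg _
  have hd : |(q' : ℝ) - q| ≤ Amax + B := by
    rw [abs_le]; constructor <;> linarith
  refine ⟨hd, by linarith, ?_⟩
  have hsq : ((q' : ℝ) - q) ^ 2 ≤ (Amax + B) ^ 2 := by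
    rw [← sq_abs]; exact pow_le_pow_left₀ (abs_nonneg _) hd 2
  -- Service is wasted only if fewer than `n ≤ B` jobs are present; then the queue holds at most
  -- `Dmax * B` work, so the wasted service adds a bounded term only.
  have hun : q * (n - min n len) ≤ Dmax * B * B := by
    rcases le_or_gt n len with hle | hlt
    · simp [min_eq_left hle]
    · refine Nat.mul_le_mul ?_ (by omega)
      calc q ≤ Dmax * len := by omega
        _ ≤ Dmax * B := Nat.mul_le_mul_left _ (by omega)
  have hun' : (q : ℝ) * (n - (min n len : ℕ)) ≤ Dmax * B * B := by
    rw [← Nat.cast_sub (min_le_left n len)]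
    exact_mod_cast hun
  have e : (q' : ℝ) - q = a - n + (n - (min n len : ℕ)) := by linarith
  have : (q' : ℝ) ^ 2 = q ^ 2 + 2 * (q * (q' - q)) + (q' - q) ^ 2 := by ring
  rw [this]
  have h3 : (q : ℝ) * (q' - q) = q * (a - n) + q * (n - (min n len : ℕ)) := by rw [e]; ring
  linarith

/-- The length of the shortest queue of type-`j` jobs. -/
def minQueue [NeZero M] (Y : S.State) (j : Fin J) : ℕ :=
  Finset.univ.inf' ⟨0, Finset.mem_univ _⟩ (queueLength Y j)

theorem minQueue_le [NeZero M] (Y : S.State) (j : Fin J) (m : Fin M) :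
    minQueue Y j ≤ queueLength Y j m :=
  Finset.inf'_le _ (Finset.mem_univ m)

theorem queueLength_of_mem_shortestQueues [NeZero M] {Y : S.State} {j : Fin J} {m : Fin M}
    (h : m ∈ shortestQueues Y j) : queueLength Y j m = minQueue Y j := by
  refine le_antisymm (Finset.le_inf' _ _ fun m' _ => ?_) (minQueue_le Y j m)
  simp only [shortestQueues, Finset.mem_filter, Finset.mem_univ, true_and] at h
  exact h m'

/-- The law of the next state, given the present state `Y` and the arrivals `A`. -/
noncomputable def slotLaw [NeZero M] (P : S.MaxWeightPolicy) (Y : S.State) (A : S.Arrivals) :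
    PMF S.State :=
  (jsqRouting Y).bind fun route => (P.schedule Y).bind fun s => P.serve (addArrivals Y A route) s

/-- `Y'` may follow on `Y` when the jobs `A` arrive, with routing `route` and schedules `s`. -/
structure Transition (Y : S.State) (A : S.Arrivals) (route : Fin J → Fin M)
    (s : Fin M → Fin J → ℕ) (Y' : S.State) : Prop where
  route_mem : ∀ j, route j ∈ shortestQueues Y j
  isMaxWeight : ∀ m, S.IsMaxWeight Y m (s m)
  served : ∀ j m, ServedOneSlot (s m j) (addArrivals Y A route j m) (Y' j m)

/-- Routing, schedules and service need only be known up to their supports: the estimates below hold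
for every outcome, and only the arrivals are averaged. -/
theorem exists_transition [NeZero M] {P : S.MaxWeightPolicy} {Y Y' : S.State} {A : S.Arrivals}
    (h : Y' ∈ (slotLaw P Y A).support) : ∃ route s, Transition Y A route s Y' := by
  simp only [slotLaw, PMF.mem_support_bind_iff] at h
  obtain ⟨route, hroute, s, hs, hY'⟩ := h
  refine ⟨route, s, fun j => ?_, P.schedule_isMaxWeight Y s hs, P.serve_servedOneSlot _ s Y' hY'⟩
  simp only [jsqRouting, PMF.mem_support_uniformOfFinset_iff, Fintype.mem_piFinset] at hroute
  exact hroute j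

namespace Transition

variable {Y Y' : S.State} {A : S.Arrivals} {route : Fin J → Fin M} {s : Fin M → Fin J → ℕ}

theorem queue_step (h : Transition Y A route s Y') {Amax : ℝ} {B : ℕ}
    (hA : ∀ j, (work (A j) : ℝ) ≤ Amax)
    (hB : ∀ m (s : Fin J → ℕ), toVec s ∈ S.hullMaximal m → ∀ j, s j ≤ B) (j : Fin J) (m : Fin M) :
    |(queueLength Y' j m : ℝ) - queueLength Y j m| ≤ Amax + B ∧
    ((if m = route j then work (A j) else 0 : ℕ) : ℝ) - s m j ≤
      (queueLength Y' j m : ℝ) - queueLength Y j m ∧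
    (queueLength Y' j m : ℝ) ^ 2 ≤ queueLength Y j m ^ 2 +
      2 * (queueLength Y j m * (((if m = route j then work (A j) else 0 : ℕ) : ℝ) - s m j)) +
      (2 * (S.Dmax * B * B) + (Amax + B) ^ 2) := by
  have hw : work (addArrivals Y A route j m) =
      queueLength Y j m + (if m = route j then work (A j) else 0) := by
    rw [addArrivals, work_append, queueLength]
    split_ifs <;> rfl
  refine CloudSystem.queue_step (hw ▸ (h.served j m).work_add) (hw ▸ work_le _)
    (hB m _ (h.isMaxWeight m).1 j) ?_
  split_ifs
  · exact hA j
  · exact_mod_cast (Nat.cast_nonneg _).trans (hA j)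

/-- All shortest queues have the same length, so the outcome of the tie-breaking disappears from the
drift. -/
theorem sum_arrivals_mul [NeZero M] (h : Transition Y A route s Y') (j : Fin J) :
    ∑ m, (queueLength Y j m : ℝ) * ((if m = route j then work (A j) else 0 : ℕ) : ℝ) =
      work (A j) * minQueue Y j := by
  rw [Finset.sum_eq_single (route j)]
  · rw [if_pos rfl, queueLength_of_mem_shortestQueues (h.route_mem j), mul_comm]
  · intro m _ hm
    simp [hm]
  · simp

theorem sum_arrivals (A : S.Arrivals) (route : Fin J → Fin M) (j : Fin J) :
    ∑ m, ((if m = route j then work (A j) else 0 : ℕ) : ℝ) = work (A j) := by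
  simp

end Transition

end Dynamics

/-! ### Queue length vectors -/

theorem norm_sub_inner_smul_sq {E : Type*} [NormedAddCommGroup E] [InnerProductSpace ℝ E] {e : E}
    (he : ‖e‖ = 1) (v : E) : ‖v - inner ℝ e v • e‖ ^ 2 = ‖v‖ ^ 2 - inner ℝ e v ^ 2 := by
  rw [norm_sub_sq_real, norm_smul, he, inner_smul_right, real_inner_comm, mul_one,
    Real.norm_eq_abs, sq_abs]
  ring

theorem norm_sub_inner_smul_le {E : Type*} [NormedAddCommGroup E] [InnerProductSpace ℝ E] {e : E}
    (he : ‖e‖ = 1) (v : E) : ‖v - inner ℝ e v • e‖ ≤ ‖v‖ := by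
  refine le_of_sq_le_sq ?_ (norm_nonneg v)
  rw [norm_sub_inner_smul_sq he]
  linarith [sq_nonneg (inner ℝ e v)]

theorem norm_le_sum_norm_row (v : EuclideanSpace ℝ (Fin J × Fin M)) :
    ‖v‖ ≤ ∑ m, ‖WithLp.toLp 2 fun j => v (j, m)‖ := by
  refine le_of_sq_le_sq ?_ (Finset.sum_nonneg fun _ _ => norm_nonneg _)
  refine le_trans (le_of_eq ?_) (Finset.sum_sq_le_sq_sum_of_nonneg fun m _ => norm_nonneg _)
  simp only [EuclideanSpace.real_norm_sq_eq]
  rw [Fintype.sum_prod_type_right]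

theorem norm_le_sum_abs {ι : Type*} [Fintype ι] (v : EuclideanSpace ℝ ι) : ‖v‖ ≤ ∑ i, |v i| := by
  refine le_of_sq_le_sq ?_ (Finset.sum_nonneg fun _ _ => abs_nonneg _)
  refine le_trans (le_of_eq ?_) (Finset.sum_sq_le_sq_sum_of_nonneg fun i _ => abs_nonneg _)
  simp only [EuclideanSpace.real_norm_sq_eq, sq_abs]

variable {S : CloudSystem I J M}

/-- The vector of the queue lengths at server `m`. -/
noncomputable def queueRow (Y : S.State) (m : Fin M) : EuclideanSpace ℝ (Fin J) :=
  WithLp.toLp 2 fun j => (queueLength Y j m : ℝ)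

theorem queueRow_apply (Y : S.State) (m : Fin M) (j : Fin J) :
    queueRow Y m j = queueLength Y j m := rfl

/-- The component of the queue lengths at server `m` perpendicular to `c`. -/
noncomputable def perpRow (c : EuclideanSpace ℝ (Fin J)) (Y : S.State) (m : Fin M) :
    EuclideanSpace ℝ (Fin J) :=
  queueRow Y m - inner ℝ c (queueRow Y m) • c

/-- The mean over the servers of the components of the queue lengths along `c`. -/
noncomputable def meanPar (c : EuclideanSpace ℝ (Fin J)) (Y : S.State) : ℝ :=
  (∑ m, inner ℝ c (queueRow Y m)) / M

/-! ### Parallel and perpendicular parts, server by server. -/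

section Norms

variable {c : EuclideanSpace ℝ (Fin J)}

theorem norm_replicate [NeZero M] (hc : ‖c‖ = 1) : ‖replicate M c‖ = 1 := by
  have hM : (0 : ℝ) < M := by exact_mod_cast NeZero.pos M
  have h : ‖replicate M c‖ ^ 2 = 1 := by
    have hc2 : ∑ j, c j ^ 2 = 1 := by rw [← EuclideanSpace.real_norm_sq_eq, hc, one_pow]
    rw [EuclideanSpace.real_norm_sq_eq, Fintype.sum_prod_type]
    simp only [replicate, div_pow, Real.sq_sqrt hM.le, Finset.sum_const, Finset.card_univ,
      Fintype.card_fin, nsmul_eq_mul]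
    rw [← hc2]
    exact Finset.sum_congr rfl fun j _ => by field_simp
  exact (pow_eq_one_iff_of_nonneg (norm_nonneg _) two_ne_zero).1 h

theorem inner_replicate (Y : S.State) :
    inner ℝ (replicate M c) (queueVec Y) =
      (∑ j, ∑ m, c j * (queueLength Y j m : ℝ)) / Real.sqrt M := by
  rw [PiLp.inner_apply, Fintype.sum_prod_type, Finset.sum_div]
  refine Finset.sum_congr rfl fun j _ => ?_
  rw [Finset.sum_div]
  refine Finset.sum_congr rfl fun m _ => ?_
  simp only [replicate, queueVec, RCLike.inner_apply, conj_trivial]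
  ring

theorem inner_replicate_div_sqrt [NeZero M] (Y : S.State) :
    inner ℝ (replicate M c) (queueVec Y) / Real.sqrt M = meanPar c Y := by
  have hM : (0 : ℝ) < M := by exact_mod_cast NeZero.pos M
  rw [inner_replicate, div_div, Real.mul_self_sqrt hM.le, meanPar, Finset.sum_comm]
  simp only [inner_eq_sum, queueRow_apply]

theorem norm_queueVec_sq (Y : S.State) :
    ‖queueVec Y‖ ^ 2 = ∑ j, ∑ m, (queueLength Y j m : ℝ) ^ 2 := by
  rw [EuclideanSpace.real_norm_sq_eq, Fintype.sum_prod_type]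
  rfl

theorem norm_queueVec_le (Y : S.State) : ‖queueVec Y‖ ≤ ∑ m, ‖queueRow Y m‖ :=
  norm_le_sum_norm_row _

theorem norm_queuePerp_sq [NeZero M] (hc : ‖c‖ = 1) (Y : S.State) :
    ‖queuePerp c Y‖ ^ 2 = ‖queueVec Y‖ ^ 2 - inner ℝ (replicate M c) (queueVec Y) ^ 2 :=
  norm_sub_inner_smul_sq (norm_replicate hc) _

theorem norm_queuePerp_le [NeZero M] (hc : ‖c‖ = 1) (Y : S.State) :
    ‖queuePerp c Y‖ ≤ ‖queueVec Y‖ :=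
  norm_sub_inner_smul_le (norm_replicate hc) _

/-- At each server the projection on the replicated vector equals `meanPar c Y • c`. -/
theorem norm_queuePerp_le_sum [NeZero M] (Y : S.State) :
    ‖queuePerp c Y‖ ≤ ∑ m, ‖queueRow Y m - meanPar c Y • c‖ := by
  refine (norm_le_sum_norm_row _).trans (le_of_eq (Finset.sum_congr rfl fun m _ => ?_))
  congr 1
  ext j
  simp only [queuePerp, queuePar, PiLp.sub_apply, PiLp.smul_apply, smul_eq_mul, queueRow_apply,
    ← inner_replicate_div_sqrt]
  simp only [queueVec, replicate]
  ring

theorem abs_norm_queuePerp_sub_le [NeZero M] (hc : ‖c‖ = 1) (Y Y' : S.State) :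
    |‖queuePerp c Y'‖ - ‖queuePerp c Y‖| ≤ ‖queueVec Y' - queueVec Y‖ := by
  refine (abs_norm_sub_norm_le _ _).trans (le_trans (le_of_eq ?_)
    (norm_sub_inner_smul_le (norm_replicate hc) (queueVec Y' - queueVec Y)))
  congr 1
  simp only [queuePerp, queuePar, inner_sub_right, sub_smul]
  abel

theorem inner_queueRow_nonneg (hc : ∀ j, 0 ≤ c j) (Y : S.State) (m : Fin M) :
    0 ≤ inner ℝ c (queueRow Y m) := by
  rw [inner_eq_sum]
  exact Finset.sum_nonneg fun j _ => mul_nonneg (hc j) (Nat.cast_nonneg _)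

theorem meanPar_nonneg (hc : ∀ j, 0 ≤ c j) (Y : S.State) : 0 ≤ meanPar c Y :=
  div_nonneg (Finset.sum_nonneg fun m _ => inner_queueRow_nonneg hc Y m) (Nat.cast_nonneg _)

theorem norm_queueRow_le (hc : ‖c‖ = 1) (hc0 : ∀ j, 0 ≤ c j) (Y : S.State) (m : Fin M) :
    ‖queueRow Y m‖ ≤ inner ℝ c (queueRow Y m) + ‖perpRow c Y m‖ := by
  have h : queueRow Y m = inner ℝ c (queueRow Y m) • c + perpRow c Y m := by
    simp [perpRow]
  calc ‖queueRow Y m‖ = ‖inner ℝ c (queueRow Y m) • c + perpRow c Y m‖ := by rw [← h]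
    _ ≤ ‖inner ℝ c (queueRow Y m) • c‖ + ‖perpRow c Y m‖ := norm_add_le _ _
    _ = _ := by
      rw [norm_smul, hc, mul_one, Real.norm_eq_abs, abs_of_nonneg (inner_queueRow_nonneg hc0 Y m)]

end Norms

/-- If a set contains the points of a hyperplane near `p`, then the support function of the set at
`q` exceeds `⟨p, q⟩` by a multiple of the component of `q` along the hyperplane. -/
theorem inner_add_norm_perp_le {C : Set (EuclideanSpace ℝ (Fin J))}
    {c p q : EuclideanSpace ℝ (Fin J)} (hc : ‖c‖ = 1) {δ T : ℝ} (hδ : 0 ≤ δ)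
    (hball : ∀ y, inner ℝ c y = inner ℝ c p → ‖y - p‖ ≤ δ → y ∈ C)
    (hT : ∀ y ∈ C, inner ℝ y q ≤ T) :
    inner ℝ p q + δ * ‖q - inner ℝ c q • c‖ ≤ T := by
  set w := q - inner ℝ c q • c with hw
  have hcw : inner ℝ c w = 0 := by
    rw [hw, inner_sub_right, inner_smul_right, real_inner_self_eq_norm_sq, hc]; ring
  rcases eq_or_ne w 0 with h0 | h0
  · rw [h0, norm_zero, mul_zero, add_zero]
    exact hT p (hball p rfl (by simpa using hδ))
  have hn : 0 < ‖w‖ := norm_pos_iff.2 h0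
  have hwq : inner ℝ w q = ‖w‖ ^ 2 := by
    have : q = w + inner ℝ c q • c := by rw [hw]; abel
    rw [← real_inner_self_eq_norm_sq]
    conv_lhs => rw [this]
    rw [inner_add_right, inner_smul_right, real_inner_comm c w, hcw, mul_zero, add_zero]
  -- The best point of the disc: `w` is perpendicular to `c`, so the test point stays on the
  -- hyperplane and gains `δ ‖w‖`.
  have h := hT (p + (δ / ‖w‖) • w) (hball _ (by
    rw [inner_add_right, inner_smul_right, hcw, mul_zero, add_zero]) (by
    rw [add_sub_cancel_left, norm_smul, Real.norm_eq_abs, abs_of_nonneg (by positivity),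
      div_mul_cancel₀ _ hn.ne']))
  rw [inner_add_left, inner_smul_left, hwq] at h
  simp only [conj_trivial] at h
  have h2 : δ / ‖w‖ * ‖w‖ ^ 2 = δ * ‖w‖ := by field_simp
  rwa [h2] at h

/-- The queue lengths of a MaxWeight schedule dominate those of every point of the capacity region. -/
theorem IsMaxWeight.inner_le [NeZero M] (hident : ∃ R₀ : Fin I → ℝ≥0, ∀ i m, S.R i m = R₀ i)
    {Y : S.State} {m : Fin M} {s : Fin J → ℕ} (h : S.IsMaxWeight Y m s)
    {y : EuclideanSpace ℝ (Fin J)} (hy : y ∈ S.capacityRegion) :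
    inner ℝ y (queueRow Y m) ≤ M * ∑ j, (s j : ℝ) * queueLength Y j m := by
  obtain ⟨x, hx, hle⟩ := exists_hullMaximal_ge hident hy m
  refine le_trans ?_ (mul_le_mul_of_nonneg_left (h.2 x hx) (Nat.cast_nonneg M))
  rw [inner_eq_sum, Finset.mul_sum]
  refine Finset.sum_le_sum fun j _ => ?_
  rw [← mul_assoc]
  exact mul_le_mul_of_nonneg_right (hle j) (Nat.cast_nonneg _)

/-- Every job carries at least one unit of work and there are finitely many sizes, so bounded queues
leave finitely many lists. -/
theorem finite_norm_queueVec_le (S : CloudSystem I J M) (t : ℝ) :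
    {Y : S.State | ‖queueVec Y‖ ≤ t}.Finite := by
  obtain ⟨n, hn⟩ := exists_nat_ge t
  have hfin : Finite S.JobSize := by
    refine Set.Finite.to_subtype ((Set.finite_Icc 1 S.Dmax).subset fun d hd => ?_)
    exact hd
  have hL : {L : List S.JobSize | L.length ≤ n}.Finite := List.finite_length_le _ n
  refine (Set.Finite.pi' fun j => Set.Finite.pi' fun m => hL).subset fun Y hY j m => ?_
  have h1 : ((queueLength Y j m : ℕ) : ℝ) ≤ n := by
    refine le_trans ?_ (le_trans hY hn)
    have := PiLp.norm_apply_le (queueVec Y) (j, m)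
    rwa [Real.norm_eq_abs, abs_of_nonneg (by simp [queueVec])] at this
  exact (length_le_work _).trans (by exact_mod_cast h1)

/-! ### Quadratic drift of the queue lengths -/

section Drift

variable {S : CloudSystem I J M}

/-- A bound for the increments of the norm of the queue lengths. -/
def incrementBound (J M B : ℕ) (Amax : ℝ) : ℝ := J * (M * (Amax + B)) + 1

/-- A bound for the second-order terms in the increments of the squared norm. -/
def secondOrderBound (S : CloudSystem I J M) (B : ℕ) (Amax : ℝ) : ℝ :=
  J * (M * (2 * (S.Dmax * B * B) + (Amax + B) ^ 2))

/-- A bound for the increment of the squared norm of the queue lengths. -/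
noncomputable def growth [NeZero M] (S : CloudSystem I J M) (c p : EuclideanSpace ℝ (Fin J))
    (δ Amax : ℝ) (B : ℕ) (Y : S.State) (A : S.Arrivals) : ℝ :=
  secondOrderBound S B Amax - 2 / M * ∑ m, (inner ℝ p (queueRow Y m) + δ * ‖perpRow c Y m‖) +
    ∑ j, 2 * (minQueue Y j : ℝ) * work (A j)

/-- A bound for the increment of the squared norm of the perpendicular queue lengths. -/
noncomputable def perpGrowth [NeZero M] (S : CloudSystem I J M) (c p : EuclideanSpace ℝ (Fin J))
    (b δ Amax : ℝ) (B : ℕ) (Y : S.State) (A : S.Arrivals) : ℝ :=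
  (secondOrderBound S B Amax - 2 / M * ∑ m, (inner ℝ p (queueRow Y m) + δ * ‖perpRow c Y m‖) +
    2 * meanPar c Y * b) + ∑ j, (2 * (minQueue Y j : ℝ) - 2 * meanPar c Y * c j) * work (A j)

/-- `perpGrowth` is arranged to be affine in the arrivals, as needed for `hasSum_affine`; this form
shows the first-order change of the squared parallel part that is subtracted. -/
theorem perpGrowth_eq [NeZero M] (c p : EuclideanSpace ℝ (Fin J)) (b δ Amax : ℝ) (B : ℕ)
    (Y : S.State) (A : S.Arrivals) : perpGrowth S c p b δ Amax B Y A =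
      growth S c p δ Amax B Y A - 2 * meanPar c Y * (∑ j, c j * (work (A j) : ℝ) - b) := by
  simp only [perpGrowth, growth, sub_mul, Finset.sum_sub_distrib, mul_sub, Finset.mul_sum, mul_assoc]
  ring

namespace Transition

variable {Y Y' : S.State} {A : S.Arrivals} {route : Fin J → Fin M} {s : Fin M → Fin J → ℕ}
  {c p : EuclideanSpace ℝ (Fin J)} {b δ Amax : ℝ} {B : ℕ}

theorem norm_queueVec_sub_le (h : Transition Y A route s Y')
    (hA : ∀ j, (work (A j) : ℝ) ≤ Amax)
    (hB : ∀ m (s : Fin J → ℕ), toVec s ∈ S.hullMaximal m → ∀ j, s j ≤ B) :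
    ‖queueVec Y' - queueVec Y‖ ≤ incrementBound J M B Amax := by
  refine (norm_le_sum_abs _).trans ?_
  rw [Fintype.sum_prod_type]
  calc _ ≤ ∑ _j : Fin J, ∑ _m : Fin M, (Amax + B) :=
        Finset.sum_le_sum fun j _ => Finset.sum_le_sum fun m _ => (h.queue_step hA hB j m).1
    _ ≤ _ := by
        simp only [Finset.sum_const, Finset.card_univ, Fintype.card_fin, nsmul_eq_mul,
          incrementBound]
        linarith

theorem norm_queueVec_sq_le [NeZero M] (h : Transition Y A route s Y')
    (hident : ∃ R₀ : Fin I → ℝ≥0, ∀ i m, S.R i m = R₀ i) (hc : ‖c‖ = 1) (hδ : 0 ≤ δ)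
    (hball : ∀ y, inner ℝ c y = inner ℝ c p → ‖y - p‖ ≤ δ → y ∈ S.capacityRegion)
    (hA : ∀ j, (work (A j) : ℝ) ≤ Amax)
    (hB : ∀ m (s : Fin J → ℕ), toVec s ∈ S.hullMaximal m → ∀ j, s j ≤ B) :
    ‖queueVec Y'‖ ^ 2 ≤ ‖queueVec Y‖ ^ 2 + growth S c p δ Amax B Y A := by
  have hM : (0 : ℝ) < M := by exact_mod_cast NeZero.pos M
  -- MaxWeight enters here: its weight at server `m` beats, up to the factor `M`, every point of the
  -- disc around `p`.
  have hsched : ∀ m, inner ℝ p (queueRow Y m) + δ * ‖perpRow c Y m‖ ≤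
      M * ∑ j, (s m j : ℝ) * queueLength Y j m := fun m =>
    inner_add_norm_perp_le hc hδ hball fun y hy => (h.isMaxWeight m).inner_le hident hy
  have hsum : 2 / M * ∑ m, (inner ℝ p (queueRow Y m) + δ * ‖perpRow c Y m‖) ≤
      2 * ∑ m, ∑ j, (s m j : ℝ) * queueLength Y j m := by
    calc _ ≤ 2 / M * ∑ m, (M * ∑ j, (s m j : ℝ) * queueLength Y j m) := by
          gcongr with m; exact hsched m
      _ = _ := by rw [← Finset.mul_sum]; field_simp
  have hwork : ∑ j, 2 * (minQueue Y j : ℝ) * work (A j) =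
      2 * ∑ j, (work (A j) : ℝ) * minQueue Y j := by
    rw [Finset.mul_sum]
    exact Finset.sum_congr rfl fun j _ => by ring
  have hcomm : ∑ m, ∑ j, (s m j : ℝ) * queueLength Y j m =
      ∑ j, ∑ m, (queueLength Y j m : ℝ) * s m j := by
    rw [Finset.sum_comm]
    exact Finset.sum_congr rfl fun j _ => Finset.sum_congr rfl fun m _ => mul_comm _ _
  rw [norm_queueVec_sq, norm_queueVec_sq]
  calc ∑ j, ∑ m, (queueLength Y' j m : ℝ) ^ 2
      ≤ ∑ j, ∑ m, ((queueLength Y j m : ℝ) ^ 2 +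
          2 * (queueLength Y j m * (((if m = route j then work (A j) else 0 : ℕ) : ℝ) - s m j)) +
          (2 * (S.Dmax * B * B) + (Amax + B) ^ 2)) :=
        Finset.sum_le_sum fun j _ => Finset.sum_le_sum fun m _ => (h.queue_step hA hB j m).2.2
    _ = ∑ j, ∑ m, (queueLength Y j m : ℝ) ^ 2 + secondOrderBound S B Amax +
          ∑ j, 2 * (minQueue Y j : ℝ) * work (A j) -
          2 * ∑ m, ∑ j, (s m j : ℝ) * queueLength Y j m := by
        simp only [Finset.sum_add_distrib, mul_sub, Finset.sum_sub_distrib, ← Finset.mul_sum,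
          h.sum_arrivals_mul, Finset.sum_const, Finset.card_univ, Fintype.card_fin, nsmul_eq_mul]
        rw [hwork, hcomm, secondOrderBound]
        ring
    _ ≤ _ := by
        rw [growth]
        linarith

/-- The schedules of all servers add up to a point of the capacity region, so they remove at most
`b` along `c`; wasted service only makes the queues longer. -/
theorem inner_replicate_le [NeZero M] (h : Transition Y A route s Y') (hc0 : ∀ j, 0 ≤ c j)
    (hb : ∀ y ∈ S.capacityRegion, inner ℝ c y ≤ b)
    (hA : ∀ j, (work (A j) : ℝ) ≤ Amax)
    (hB : ∀ m (s : Fin J → ℕ), toVec s ∈ S.hullMaximal m → ∀ j, s j ≤ B) :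
    (∑ j, c j * (work (A j) : ℝ) - b) / Real.sqrt M ≤
      inner ℝ (replicate M c) (queueVec Y') - inner ℝ (replicate M c) (queueVec Y) := by
  have hs := hb _ (sum_toVec_mem_capacityRegion fun m => (h.isMaxWeight m).1)
  have hs' : ∑ j, ∑ m, c j * (s m j : ℝ) ≤ b := by
    rw [inner_eq_sum] at hs
    simpa [WithLp.ofLp_sum, Finset.mul_sum, toVec] using hs
  rw [inner_replicate, inner_replicate, ← sub_div]
  refine div_le_div_of_nonneg_right ?_ (Real.sqrt_nonneg _)
  calc ∑ j, c j * (work (A j) : ℝ) - b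
      ≤ ∑ j, ∑ m, (c j * (((if m = route j then work (A j) else 0 : ℕ) : ℝ) - s m j)) := by
        simp only [mul_sub, Finset.sum_sub_distrib, ← Finset.mul_sum, sum_arrivals] at hs' ⊢
        linarith
    _ ≤ ∑ j, ∑ m, (c j * ((queueLength Y' j m : ℝ) - queueLength Y j m)) :=
        Finset.sum_le_sum fun j _ => Finset.sum_le_sum fun m _ =>
          mul_le_mul_of_nonneg_left (h.queue_step hA hB j m).2.1 (hc0 j)
    _ = _ := by simp only [mul_sub, Finset.sum_sub_distrib]

theorem norm_queuePerp_sq_le [NeZero M] (h : Transition Y A route s Y')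
    (hident : ∃ R₀ : Fin I → ℝ≥0, ∀ i m, S.R i m = R₀ i) (hc : ‖c‖ = 1) (hc0 : ∀ j, 0 ≤ c j)
    (hb : ∀ y ∈ S.capacityRegion, inner ℝ c y ≤ b) (hδ : 0 ≤ δ)
    (hball : ∀ y, inner ℝ c y = inner ℝ c p → ‖y - p‖ ≤ δ → y ∈ S.capacityRegion)
    (hA : ∀ j, (work (A j) : ℝ) ≤ Amax)
    (hB : ∀ m (s : Fin J → ℕ), toVec s ∈ S.hullMaximal m → ∀ j, s j ≤ B) :
    ‖queuePerp c Y'‖ ^ 2 ≤ ‖queuePerp c Y‖ ^ 2 + perpGrowth S c p b δ Amax B Y A := by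
  have hM : (0 : ℝ) < M := by exact_mod_cast NeZero.pos M
  have h1 := h.norm_queueVec_sq_le hident hc hδ hball hA hB
  have h2 := h.inner_replicate_le hc0 hb hA hB
  have h3 := inner_replicate_div_sqrt (c := c) Y
  have h4 := meanPar_nonneg hc0 Y
  rw [norm_queuePerp_sq hc, norm_queuePerp_sq hc, perpGrowth_eq]
  set x := inner ℝ (replicate M c) (queueVec Y)
  set x' := inner ℝ (replicate M c) (queueVec Y')
  have hx : x = meanPar c Y * Real.sqrt M := by
    rw [← h3, div_mul_cancel₀ _ (Real.sqrt_pos.2 hM).ne']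
  have h5 : meanPar c Y * (∑ j, c j * (work (A j) : ℝ) - b) ≤ x * (x' - x) := by
    rw [div_le_iff₀ (Real.sqrt_pos.2 hM)] at h2
    calc _ ≤ meanPar c Y * ((x' - x) * Real.sqrt M) := mul_le_mul_of_nonneg_left h2 h4
      _ = _ := by rw [hx]; ring
  -- Convexity of the square: `x' ^ 2 ≥ x ^ 2 + 2 x (x' - x)`.
  nlinarith [sq_nonneg (x' - x)]

end Transition

theorem hasSum_work (ν : PMF S.Arrivals) {Amax : ℝ}
    (hA : ∀ A ∈ ν.support, ∀ j, (work (A j) : ℝ) ≤ Amax) (j : Fin J) :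
    HasSum (fun A => (ν A).toReal * (work (A j) : ℝ)) (arrivalRate ν j) := by
  refine Summable.hasSum ?_
  refine Summable.of_nonneg_of_le (fun A => by positivity) (fun A => ?_)
    (ν.hasSum_toReal.summable.mul_right Amax)
  by_cases h : ν A = 0
  · simp [h]
  · exact mul_le_mul_of_nonneg_left (hA A ((ν.mem_support_iff A).2 h) j) ENNReal.toReal_nonneg

theorem hasSum_affine (ν : PMF S.Arrivals) {Amax : ℝ}
    (hA : ∀ A ∈ ν.support, ∀ j, (work (A j) : ℝ) ≤ Amax) (h : ℝ) (g : Fin J → ℝ) :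
    HasSum (fun A => (ν A).toReal * (h + ∑ j, g j * (work (A j) : ℝ)))
      (h + ∑ j, g j * arrivalRate ν j) := by
  have h1 := (ν.hasSum_toReal.mul_right h).add
    (hasSum_sum (s := Finset.univ) fun j _ => (hasSum_work ν hA j).mul_left (g j))
  rw [one_mul] at h1
  refine Eq.subst (motive := fun f => HasSum f _) (funext fun A => ?_) h1
  rw [mul_add, Finset.mul_sum]
  congr 1
  exact Finset.sum_congr rfl fun j _ => by ring

/-- JSQ routes no more work, weighted by queue lengths, than uniform routing. -/
theorem sum_minQueue_le [NeZero M] (Y : S.State) {lam : EuclideanSpace ℝ (Fin J)}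
    (hlam : ∀ j, 0 ≤ lam j) :
    ∑ j, (minQueue Y j : ℝ) * lam j ≤ (∑ m, inner ℝ lam (queueRow Y m)) / M := by
  have hM : (0 : ℝ) < M := by exact_mod_cast NeZero.pos M
  rw [le_div_iff₀ hM]
  calc (∑ j, (minQueue Y j : ℝ) * lam j) * M = ∑ _m : Fin M, ∑ j, (minQueue Y j : ℝ) * lam j := by
        simp [mul_comm]
    _ ≤ _ := by
        refine Finset.sum_le_sum fun m _ => ?_
        rw [inner_eq_sum]
        refine Finset.sum_le_sum fun j _ => ?_
        rw [mul_comm]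
        exact mul_le_mul_of_nonneg_left (Nat.cast_le.2 (minQueue_le Y j m)) (hlam j)

/-- The mean work sent to the queues, weighted by their lengths, under JSQ routing falls short of
that under uniform routing, unless the queue lengths along `c` are balanced. -/
theorem inner_sub_le_spread [NeZero M] (Y : S.State) {lam : EuclideanSpace ℝ (Fin J)}
    (hlam : ∀ j, 0 ≤ lam j) (m : Fin M) :
    (∑ m, inner ℝ lam (queueRow Y m)) / M - inner ℝ lam (queueRow Y m) ≤
      (∑ m, inner ℝ lam (queueRow Y m)) / M - ∑ j, (minQueue Y j : ℝ) * lam j := by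
  refine sub_le_sub_left ?_ _
  rw [inner_eq_sum]
  refine Finset.sum_le_sum fun j _ => ?_
  rw [mul_comm]
  exact mul_le_mul_of_nonneg_left (Nat.cast_le.2 (minQueue_le Y j m)) (hlam j)

/-- The difference of the mean of finitely many numbers and any of them is at most their number
times the largest amount by which one of them falls below the mean. -/
theorem abs_sub_mean_le [NeZero M] {α : Fin M → ℝ} {H : ℝ} (hH : 0 ≤ H)
    (h : ∀ m, (∑ m, α m) / M - α m ≤ H) (m : Fin M) : |α m - (∑ m, α m) / M| ≤ M * H := by
  have hM : (0 : ℝ) < M := by exact_mod_cast NeZero.pos M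
  have hM1 : (1 : ℝ) ≤ M := by exact_mod_cast NeZero.pos M
  rw [abs_le]
  constructor
  · nlinarith [h m]
  · have h1 : ∑ m', ((∑ m, α m) / M - α m') = 0 := by
      rw [Finset.sum_sub_distrib]
      simp only [Finset.sum_const, Finset.card_univ, Fintype.card_fin, nsmul_eq_mul]
      field_simp
      ring
    -- These numbers are nonnegative with sum `M * H`, so none of them exceeds `M * H`.
    have h2 : ∑ m', (H - ((∑ m, α m) / M - α m')) = M * H := by
      rw [Finset.sum_sub_distrib, h1]
      simp
    have h3 := Finset.single_le_sum (f := fun m' => H - ((∑ m, α m) / M - α m'))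
      (fun m' _ => sub_nonneg.2 (h m')) (Finset.mem_univ m)
    rw [h2] at h3
    linarith

section Bounds

variable [NeZero M] {c lam : EuclideanSpace ℝ (Fin J)}

/-- At server `m` the perpendicular vector is the imbalance `⟨c, q_m⟩ - meanPar` times `c`, plus
`perpRow`. The JSQ gain bounds how far `⟨lam, q_m⟩` lies below its mean. Up to an error `2 Λ ∑
‖perpRow‖` this is `⟨lam, c⟩ ≥ β` times the deficit along `c`, and one-sided bounds on deviations
from a mean are two-sided up to a factor `M`. -/
theorem norm_queuePerp_le_spread (hc : ‖c‖ = 1) (Y : S.State) (hlam : ∀ j, 0 ≤ lam j) {β Λ : ℝ}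
    (hβ : 0 < β) (hlc : β ≤ inner ℝ lam c) (hΛ : ‖lam‖ ≤ Λ) :
    ‖queuePerp c Y‖ ≤ M ^ 2 / β *
      ((∑ m, inner ℝ lam (queueRow Y m)) / M - ∑ j, (minQueue Y j : ℝ) * lam j) +
      (2 * Λ * M ^ 2 / β + 1) * ∑ m, ‖perpRow c Y m‖ := by
  have hM : (0 : ℝ) < M := by exact_mod_cast NeZero.pos M
  have hM1 : (1 : ℝ) ≤ M := by exact_mod_cast NeZero.pos M
  set G := (∑ m, inner ℝ lam (queueRow Y m)) / M - ∑ j, (minQueue Y j : ℝ) * lam j with hG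
  set W := ∑ m, ‖perpRow c Y m‖ with hW
  have hG0 : 0 ≤ G := sub_nonneg.2 (sum_minQueue_le Y hlam)
  have hW0 : 0 ≤ W := Finset.sum_nonneg fun _ _ => norm_nonneg _
  have hΛ0 : 0 ≤ Λ := (norm_nonneg _).trans hΛ
  have hrow : ∀ m, inner ℝ lam (queueRow Y m) =
      inner ℝ c (queueRow Y m) * inner ℝ lam c + inner ℝ lam (perpRow c Y m) := fun m => by
    rw [perpRow, inner_sub_right, inner_smul_right]; ring
  have hperp : ∀ m, |inner ℝ lam (perpRow c Y m)| ≤ Λ * ‖perpRow c Y m‖ := fun m =>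
    (abs_real_inner_le_norm _ _).trans (mul_le_mul_of_nonneg_right hΛ (norm_nonneg _))
  have hperpW : ∀ m, inner ℝ lam (perpRow c Y m) ≤ Λ * W := fun m =>
    (le_abs_self _).trans ((hperp m).trans (mul_le_mul_of_nonneg_left
      (Finset.single_le_sum (fun _ _ => norm_nonneg _) (Finset.mem_univ m)) hΛ0))
  have hperpsum : -(Λ * W) ≤ (∑ m, inner ℝ lam (perpRow c Y m)) / M := by
    rw [le_div_iff₀ hM]
    have h1 : -(Λ * W) ≤ ∑ m, inner ℝ lam (perpRow c Y m) := by
      rw [hW, Finset.mul_sum, ← Finset.sum_neg_distrib]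
      exact Finset.sum_le_sum fun m _ => (abs_le.1 (hperp m)).1
    have h2 : 0 ≤ Λ * W := mul_nonneg hΛ0 hW0
    nlinarith
  have hmean : (∑ m, inner ℝ lam (queueRow Y m)) / M =
      meanPar c Y * inner ℝ lam c + (∑ m, inner ℝ lam (perpRow c Y m)) / M := by
    simp only [hrow, Finset.sum_add_distrib, ← Finset.sum_mul, meanPar]
    ring
  set H := (G + 2 * Λ * W) / β with hH
  have hH0 : 0 ≤ H :=
    div_nonneg (add_nonneg hG0 (mul_nonneg (mul_nonneg zero_le_two hΛ0) hW0)) hβ.le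
  have hdev : ∀ m, meanPar c Y - inner ℝ c (queueRow Y m) ≤ H := by
    intro m
    have h1 := inner_sub_le_spread Y hlam m
    rw [← hG, hmean, hrow m] at h1
    have h2 : (meanPar c Y - inner ℝ c (queueRow Y m)) * inner ℝ lam c ≤ G + 2 * Λ * W := by
      linarith [hperpW m]
    rcases le_or_gt (meanPar c Y - inner ℝ c (queueRow Y m)) 0 with h3 | h3
    · exact h3.trans hH0
    · rw [hH, le_div_iff₀ hβ]
      exact (mul_le_mul_of_nonneg_left hlc h3.le).trans h2
  have habs : ∀ m, |inner ℝ c (queueRow Y m) - meanPar c Y| ≤ M * H := fun m =>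
    abs_sub_mean_le (α := fun m => inner ℝ c (queueRow Y m)) hH0 hdev m
  calc ‖queuePerp c Y‖ ≤ ∑ m, ‖queueRow Y m - meanPar c Y • c‖ := norm_queuePerp_le_sum Y
    _ ≤ ∑ m, (M * H + ‖perpRow c Y m‖) := by
        refine Finset.sum_le_sum fun m _ => ?_
        have e : queueRow Y m - meanPar c Y • c =
            (inner ℝ c (queueRow Y m) - meanPar c Y) • c + perpRow c Y m := by
          rw [perpRow, sub_smul]; abel
        rw [e]
        refine (norm_add_le _ _).trans (add_le_add_left ?_ _)
        rw [norm_smul, hc, mul_one]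
        exact habs m
    _ = M ^ 2 * H + W := by
        rw [Finset.sum_add_distrib]
        simp
        ring
    _ = _ := by rw [hH]; ring

end Bounds

end Drift

/-! ### Drift of the full and of the perpendicular queue vector. -/

section Stability

variable {S : CloudSystem I J M} {c p : EuclideanSpace ℝ (Fin J)}
  {b δ ε Amax : ℝ} {B : ℕ} {ν : PMF S.Arrivals}

theorem sum_growth_terms (Y : S.State) {lam : EuclideanSpace ℝ (Fin J)} (hp : lam + ε • c = p) :
    2 / M * ∑ m, (inner ℝ p (queueRow Y m) + δ * ‖perpRow c Y m‖) =
      2 * ((∑ m, inner ℝ lam (queueRow Y m)) / M) + 2 * ε * meanPar c Y +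
        2 * (δ / M) * ∑ m, ‖perpRow c Y m‖ := by
  simp only [← hp, inner_add_left, inner_smul_left, conj_trivial, Finset.sum_add_distrib,
    ← Finset.mul_sum, meanPar]
  ring

/-- The queue lengths have negative drift of order `ε` when the arrival rates lie at distance `ε`
below the relative interior of a face of the capacity region. -/
theorem quadraticDrift_queueVec [NeZero M] (P : S.MaxWeightPolicy)
    (hident : ∃ R₀ : Fin I → ℝ≥0, ∀ i m, S.R i m = R₀ i) (hc : ‖c‖ = 1) (hc0 : ∀ j, 0 ≤ c j)
    (hδ : 0 ≤ δ) (hball : ∀ y, inner ℝ c y = inner ℝ c p → ‖y - p‖ ≤ δ → y ∈ S.capacityRegion)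
    (hA : ∀ A ∈ ν.support, ∀ j, (work (A j) : ℝ) ≤ Amax)
    (hB : ∀ m (s : Fin J → ℕ), toVec s ∈ S.hullMaximal m → ∀ j, s j ≤ B)
    (hlam : ∀ j, 0 ≤ arrivalRate ν j) (hp : arrivalRate ν + ε • c = p)
    {η : ℝ} (hη : 0 ≤ η)
    (hηδ : η ≤ δ / M) (hηε : η ≤ ε / M) :
    PMF.QuadraticDrift ν (slotLaw P) (fun Y => ‖queueVec Y‖) (growth S c p δ Amax B)
      (incrementBound J M B Amax) (secondOrderBound S B Amax) η where
  nonneg Y := norm_nonneg _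
  abs_sub_le Y A hAν Y' hY' := by
    obtain ⟨route, s, h⟩ := exists_transition hY'
    exact (abs_norm_sub_norm_le _ _).trans (h.norm_queueVec_sub_le (hA A hAν) hB)
  sq_le Y A hAν Y' hY' := by
    obtain ⟨route, s, h⟩ := exists_transition hY'
    exact h.norm_queueVec_sq_le hident hc hδ hball (hA A hAν) hB
  mean_le Y := by
    refine ⟨_, hasSum_affine ν hA _ _, ?_⟩
    have hM : (0 : ℝ) < M := by exact_mod_cast NeZero.pos M
    have hjsq := sum_minQueue_le Y hlam
    have hnorm : ‖queueVec Y‖ ≤ M * meanPar c Y + ∑ m, ‖perpRow c Y m‖ := by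
      refine (norm_queueVec_le Y).trans
        ((Finset.sum_le_sum fun m _ => norm_queueRow_le hc hc0 Y m).trans (le_of_eq ?_))
      rw [Finset.sum_add_distrib, meanPar, mul_div_cancel₀ _ hM.ne']
    -- The part along `c` is paid for by the slack `ε`, the rest by the radius `δ` of the disc.
    have h1 : η * ‖queueVec Y‖ ≤ ε * meanPar c Y + δ / M * ∑ m, ‖perpRow c Y m‖ := by
      refine (mul_le_mul_of_nonneg_left hnorm hη).trans ?_
      rw [mul_add, ← mul_assoc]
      refine add_le_add (mul_le_mul_of_nonneg_right ?_ (meanPar_nonneg hc0 Y))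
        (mul_le_mul_of_nonneg_right hηδ (Finset.sum_nonneg fun _ _ => norm_nonneg _))
      rwa [le_div_iff₀ hM] at hηε
    rw [sum_growth_terms Y hp]
    have h2 : ∑ j, 2 * (minQueue Y j : ℝ) * arrivalRate ν j =
        2 * ∑ j, (minQueue Y j : ℝ) * arrivalRate ν j := by
      simp only [Finset.mul_sum, mul_assoc]
    rw [h2]
    linarith

/-- The rate of the negative drift of the perpendicular queue lengths. -/
noncomputable def perpRate (M : ℕ) (β Λ δ : ℝ) : ℝ :=
  min (β / M ^ 2) (δ / M / (2 * Λ * M ^ 2 / β + 1))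

theorem perpRate_pos [NeZero M] {β Λ : ℝ} (hβ : 0 < β) (hΛ : 0 ≤ Λ) (hδ : 0 < δ) :
    0 < perpRate M β Λ δ := by
  have hM : (0 : ℝ) < M := by exact_mod_cast NeZero.pos M
  exact lt_min (by positivity) (by positivity)

/-- The perpendicular queue lengths have negative drift whose rate does not depend on the distance
`ε` of the arrival rates to the hyperplane. -/
theorem quadraticDrift_queuePerp [NeZero M] (P : S.MaxWeightPolicy)
    (hident : ∃ R₀ : Fin I → ℝ≥0, ∀ i m, S.R i m = R₀ i) (hc : ‖c‖ = 1) (hc0 : ∀ j, 0 ≤ c j)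
    (hb : ∀ y ∈ S.capacityRegion, inner ℝ c y ≤ b) (hpb : inner ℝ c p = b) (hδ : 0 ≤ δ)
    (hball : ∀ y, inner ℝ c y = inner ℝ c p → ‖y - p‖ ≤ δ → y ∈ S.capacityRegion)
    (hA : ∀ A ∈ ν.support, ∀ j, (work (A j) : ℝ) ≤ Amax)
    (hB : ∀ m (s : Fin J → ℕ), toVec s ∈ S.hullMaximal m → ∀ j, s j ≤ B)
    (hlam : ∀ j, 0 ≤ arrivalRate ν j) (hp : arrivalRate ν + ε • c = p) {β Λ : ℝ} (hβ : 0 < β)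
    (hβε : β ≤ b - ε) (hΛ : ‖arrivalRate ν‖ ≤ Λ) :
    PMF.QuadraticDrift ν (slotLaw P) (fun Y => ‖queuePerp c Y‖) (perpGrowth S c p b δ Amax B)
      (incrementBound J M B Amax) (secondOrderBound S B Amax) (perpRate M β Λ δ) where
  nonneg Y := norm_nonneg _
  abs_sub_le Y A hAν Y' hY' := by
    obtain ⟨route, s, h⟩ := exists_transition hY'
    exact (abs_norm_queuePerp_sub_le hc _ _).trans (h.norm_queueVec_sub_le (hA A hAν) hB)
  sq_le Y A hAν Y' hY' := by
    obtain ⟨route, s, h⟩ := exists_transition hY'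
    exact h.norm_queuePerp_sq_le hident hc hc0 hb hδ hball (hA A hAν) hB
  mean_le Y := by
    refine ⟨_, hasSum_affine ν hA _ _, ?_⟩
    have hM : (0 : ℝ) < M := by exact_mod_cast NeZero.pos M
    have hΛ0 : 0 ≤ Λ := (norm_nonneg _).trans hΛ
    have hclam : inner ℝ c (arrivalRate ν) = b - ε := by
      have h : inner ℝ c (arrivalRate ν + ε • c) = b := by rw [hp, hpb]
      rw [inner_add_right, inner_smul_right, real_inner_self_eq_norm_sq, hc] at h
      linarith
    have hspread := norm_queuePerp_le_spread hc Y hlam hβ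
      (hβε.trans (by rw [real_inner_comm, hclam])) hΛ
    have hjsq := sub_nonneg.2 (sum_minQueue_le Y hlam)
    have hden : 0 < 2 * Λ * M ^ 2 / β + 1 := by positivity
    have hη0 : 0 ≤ perpRate M β Λ δ := le_min (by positivity) (by positivity)
    -- The rate is the largest for which the two coefficients of the spread bound fit below those of
    -- the drift, `1` for the JSQ gain and `δ / M` for the perpendicular rows.
    have hη1 : perpRate M β Λ δ * (M ^ 2 / β) ≤ 1 := by
      refine (mul_le_mul_of_nonneg_right (min_le_left _ _) (by positivity)).trans (le_of_eq ?_)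
      field_simp
    have hη2 : perpRate M β Λ δ * (2 * Λ * M ^ 2 / β + 1) ≤ δ / M := by
      refine (mul_le_mul_of_nonneg_right (min_le_right _ _) hden.le).trans (le_of_eq ?_)
      exact div_mul_cancel₀ _ hden.ne'
    have h1 := mul_le_mul_of_nonneg_left hspread hη0
    rw [mul_add, ← mul_assoc, ← mul_assoc] at h1
    have h2 := mul_le_mul_of_nonneg_right hη1 hjsq
    have h3 := mul_le_mul_of_nonneg_right hη2
      (Finset.sum_nonneg (s := Finset.univ) fun m _ => norm_nonneg (perpRow c Y m))
    -- Together with `2 * meanPar * b` from `perpGrowth` this leaves `2 * ε * meanPar`, which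
    -- cancels the `ε`-term of `sum_growth_terms`. Hence the rate does not depend on `ε`.
    have h4 : ∑ j, (2 * (minQueue Y j : ℝ) - 2 * meanPar c Y * c j) * arrivalRate ν j =
        2 * ∑ j, (minQueue Y j : ℝ) * arrivalRate ν j - 2 * meanPar c Y * (b - ε) := by
      rw [← hclam, inner_eq_sum]
      simp only [sub_mul, Finset.sum_sub_distrib, Finset.mul_sum, mul_assoc]
    rw [sum_growth_terms Y hp, h4]
    linarith

end Stability

end CloudSystem

/-! ### Moment bounds uniform in the distance to the hyperplane. -/

theorem proposition2 {I J M : ℕ} [NeZero M] (S : CloudSystem I J M)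
    (hident : ∃ R₀ : Fin I → ℝ≥0, ∀ i m, S.R i m = R₀ i)
    (hint : (interior S.capacityRegion).Nonempty)
    {K : ℕ} (c : Fin K → EuclideanSpace ℝ (Fin J)) (b : Fin K → ℝ) (hcb : S.IsBoundedBy c b)
    (k : Fin K) (lamk : EuclideanSpace ℝ (Fin J)) (Amax : ℝ) :
    ∃ N : ℕ → ℝ≥0, ∀ (ν : PMF S.Arrivals) (P : S.MaxWeightPolicy),
      (∀ A ∈ ν.support, ∀ j, (CloudSystem.work (A j) : ℝ) ≤ Amax) →
      CloudSystem.arrivalRate ν ∈ S.capacityRegion →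
      0 < CloudSystem.distTo (c k) (b k) (CloudSystem.arrivalRate ν) →
      CloudSystem.closestPoint (c k) (b k) (CloudSystem.arrivalRate ν) = lamk →
      k ∈ S.dominantInterior c b (CloudSystem.arrivalRate ν) →
      (∃ π : PMF S.State, S.IsSteadyState ν P π) ∧
      ∀ π : PMF S.State, S.IsSteadyState ν P π → ∀ r : ℕ, 1 ≤ r →
        ∑' Y : S.State, π Y * ENNReal.ofReal (‖CloudSystem.queuePerp (c k) Y‖ ^ r) ≤ N r := by
  -- The constants precede the arrival law, so the geometry of the prescribed point is settled
  -- first; off the relative interior no arrival law qualifies.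
  by_cases hlamk : lamk ∈ intrinsicInterior ℝ
      (S.capacityRegion ∩ CloudSystem.hyperplane (c k) (b k))
  swap
  · refine ⟨0, fun ν P _ _ _ hclosest hdom => absurd hdom.2 ?_⟩
    rwa [hclosest]
  obtain ⟨δ, hδ, hball⟩ := hcb.exists_ball_subset_face hint k hlamk
  have hpk : inner ℝ (c k) lamk = b k := (intrinsicInterior_subset hlamk).2
  rw [← hpk] at hball
  obtain ⟨B, hB⟩ := S.exists_schedule_bound
  have hM : (0 : ℝ) < M := by exact_mod_cast NeZero.pos M
  have hbk := hcb.offset_pos hint k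
  have hc := hcb.norm_eq_one k
  have hc0 := hcb.normal_nonneg k
  -- The absolute value keeps the constants nonnegative for every real `Amax`; the summand 1 in
  -- `incrementBound` makes `D` positive.
  set D := CloudSystem.incrementBound J M B |Amax|
  set Q := CloudSystem.secondOrderBound S B |Amax|
  have hD : 0 < D := by
    have : 0 ≤ |Amax| := abs_nonneg _
    simp only [D, CloudSystem.incrementBound]
    positivity
  have hQ : 0 ≤ Q := by
    simp only [Q, CloudSystem.secondOrderBound]
    positivity
  -- `η₁` serves the case `ε ≥ b/2`, by the drift of the full norm; `η₂` serves `ε < b/2`, where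
  -- `⟨λ, c⟩ ≥ b/2` and `‖λ‖ ≤ ‖lamk‖ + b`.
  set η₁ := min (δ / M) (b k / 2 / M)
  set η₂ := CloudSystem.perpRate M (b k / 2) (‖lamk‖ + b k) δ
  have hη₁ : 0 < η₁ := lt_min (by positivity) (by positivity)
  have hη₂ : 0 < η₂ := CloudSystem.perpRate_pos (by positivity) (by positivity) hδ
  refine ⟨fun r => max (PMF.QuadraticDrift.momentBound D Q η₁ r)
    (PMF.QuadraticDrift.momentBound D Q η₂ r), fun ν P hA hlam hε hclosest _ => ?_⟩
  set ε := CloudSystem.distTo (c k) (b k) (CloudSystem.arrivalRate ν)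
  have hA' : ∀ A ∈ ν.support, ∀ j, (CloudSystem.work (A j) : ℝ) ≤ |Amax| :=
    fun A hAν j => (hA A hAν j).trans (le_abs_self _)
  have hp : CloudSystem.arrivalRate ν + ε • c k = lamk := hclosest
  have hlam0 := (hcb.mem_iff.1 hlam).1
  constructor
  -- For existence alone the rate may degenerate with `ε`.
  · exact (CloudSystem.quadraticDrift_queueVec P hident hc hc0 hδ.le hball hA' hB hlam0 hp
      (le_min (by positivity) (by positivity)) (min_le_left _ _) (min_le_right _ _)).exists_invariant
      hD hQ (lt_min (div_pos hδ hM) (div_pos hε hM)) S.finite_norm_queueVec_le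
  · intro π hπ r _
    rcases le_or_gt (b k / 2) ε with hbε | hbε
    · have h := (CloudSystem.quadraticDrift_queueVec P hident hc hc0 hδ.le hball hA' hB hlam0 hp
        hη₁.le (min_le_left _ _) ((min_le_right _ _).trans
          (div_le_div_of_nonneg_right hbε hM.le))).moment_le hD hQ hη₁ hπ r
      refine le_trans (ENNReal.tsum_le_tsum fun Y => mul_le_mul_right
        (ENNReal.ofReal_le_ofReal (pow_le_pow_left₀ (norm_nonneg _)
          (CloudSystem.norm_queuePerp_le hc Y) r)) _) (h.trans ?_)
      exact_mod_cast le_max_left _ _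
    · have hΛ : ‖CloudSystem.arrivalRate ν‖ ≤ ‖lamk‖ + b k := by
        have e : CloudSystem.arrivalRate ν = lamk - ε • c k := by rw [← hp, add_sub_cancel_right]
        rw [e]
        refine (norm_sub_le _ _).trans (add_le_add_right ?_ _)
        rw [norm_smul, hc, mul_one, Real.norm_eq_abs, abs_of_pos hε]
        linarith
      have h := (CloudSystem.quadraticDrift_queuePerp P hident hc hc0
        (fun y hy => (hcb.mem_iff.1 hy).2 k) hpk hδ.le hball hA' hB hlam0 hp (half_pos hbk)
        (by linarith) hΛ).moment_le hD hQ hη₂ hπ r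
      refine h.trans ?_
      exact_mod_cast le_max_right _ _
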